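/- Let $(\Omega,\mathcal F,P)$ be a probability space and let $W$ be a real random variable with a BKR-decomposition (Barbour--Karoński--Ruciński), i.e. there are a finite index set $J$, subsets $N_j\subseteq J$ for $j\in J$, and real square integrable random variables $X_j, W_j, Z_j$ ($j\in J$) and $Z_{jk}, W_{jk}, V_{jk}$ ($j\in J$, $k\in N_j$) such that $W$ is square integrable, $E[W^2]=1$, $E[X_j]=0$ for all $j$, and almost surely $$W=\sum_{j\in J}X_j,\qquad W=W_j+Z_j,\qquad Z_j=\sum_{k\in N_j}Z_{jk},\qquad W_j=W_{jk}+V_{jk}\quad(j\in J,\ k\in N_j),$$ where $W_j$ is independent of $X_j$ for every $j\in J$, and $W_{jk}$ is independent of the pair $(X_j,Z_{jk})$ for all $j\in J$, $k\in N_j$. For $l\in\mathbb N$ and $z\in\mathbb R$ put $R_l(z)=\sum_{m=0}^\infty \frac{(iz)^m}{(m+l)!}$. Write $\operatorname{Var}(Y)=E|Y-E[Y]|^2\in[0,\infty]$ for the variance of a complex random variable ($\operatorname{Var}(Y)=\infty$ if $Y$ is not square integrable). Define $A\in[0,\infty]$ by $$A=\frac12\sum_{j\in J}E\big[|X_j|Z_j^2\big]+\sum_{j\in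 J}\sum_{k\in N_j}\Big(E\big|X_jZ_{jk}(Z_j+V_{jk})\big|+E|X_jZ_{jk}|\;E|Z_j+V_{jk}|\Big)$$ and $B=\sup_{t\in\mathbb R}B(t)\in[0,\infty]$, where $$\begin{aligned}B(t)={}&\operatorname{Var}\Big(\sum_{j\in J}X_jZ_j^2R_2(-tZ_j)\Big)^{1/2}+\operatorname{Var}\Big(\sum_{j\in J}\sum_{k\in N_j}X_jZ_{jk}(Z_j+V_{jk})R_1(-t(Z_j+V_{jk}))\Big)^{1/2}\\&+\operatorname{Var}\Big(\sum_{j\in J}\sum_{k\in N_j}E[X_jZ_{jk}](Z_j+V_{jk})R_1(-t(Z_j+V_{jk}))\Big)^{1/2}.\end{aligned}$$ Then $A>0$ and $$\sup_{x\in\mathbb R}\big|P(W\le x)-\Phi(x)\big|\;\le\;\Big(\frac{4}{3\sqrt\pi}+\frac{24\sqrt2}{\pi\sqrt\pi}\Big)A+\frac2\pi\cdot\frac BA ,$$ where $\Phi$ is the distribution function of $N(0,1)$. (The right-hand side is $\infty$, and the bound is void, if $A=\infty$ or $B=\infty$.) -/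

import Mathlib

open MeasureTheory ProbabilityTheory
open scoped ENNReal Nat

noncomputable section

/-- The Kolmogorov distance `sup_x |μ((-∞, x]) - ν((-∞, x])|` of two probability laws on `ℝ`. -/
def kolmogorovDist (μ ν : Measure ℝ) : ℝ :=
  ⨆ x : ℝ, |cdf μ x - cdf ν x|

/-- The entire function `R_l(z) = ∑_{m ≥ 0} (i z)^m / (m + l)!`, for real `z`. -/
def taylorR (l : ℕ) (z : ℝ) : ℂ :=
  ∑' m : ℕ, (Complex.I * (z : ℂ)) ^ m / ((m + l)! : ℂ)

/-- The variance `E |Y - E Y|²` of a complex random variable, with values in `[0, ∞]`.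
It is infinite when `Y` is measurable but not square integrable. -/
def complexEVariance {Ω : Type*} [MeasurableSpace Ω] (Y : Ω → ℂ) (P : Measure Ω) : ℝ≥0∞ :=
  ∫⁻ ω, ‖Y ω - ∫ ω', Y ω' ∂P‖ₑ ^ 2 ∂P

/-- A Barbour-Karoński-Ruciński decomposition of the random variable `W` over the finite index
set `J`. The values of `Zjk j k`, `Wjk j k`, `Vjk j k` are only relevant for `k ∈ N j`. -/
structure BKRDecomposition {Ω : Type*} [MeasurableSpace Ω] (P : Measure Ω) (W : Ω → ℝ)
    (J : Type*) [Fintype J] where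
  /-- the neighbourhoods `N_j ⊆ J` -/
  N : J → Finset J
  /-- the summands `X_j` -/
  X : J → Ω → ℝ
  /-- the variables `W_j` -/
  Wj : J → Ω → ℝ
  /-- the variables `Z_j` -/
  Zj : J → Ω → ℝ
  /-- the variables `Z_{jk}`, for `k ∈ N_j` -/
  Zjk : J → J → Ω → ℝ
  /-- the variables `W_{jk}`, for `k ∈ N_j` -/
  Wjk : J → J → Ω → ℝ
  /-- the variables `V_{jk}`, for `k ∈ N_j` -/
  Vjk : J → J → Ω → ℝ
  memLp_W : MemLp W 2 P
  memLp_X : ∀ j, MemLp (X j) 2 P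
  memLp_Wj : ∀ j, MemLp (Wj j) 2 P
  memLp_Zj : ∀ j, MemLp (Zj j) 2 P
  memLp_Zjk : ∀ j, ∀ k ∈ N j, MemLp (Zjk j k) 2 P
  memLp_Wjk : ∀ j, ∀ k ∈ N j, MemLp (Wjk j k) 2 P
  memLp_Vjk : ∀ j, ∀ k ∈ N j, MemLp (Vjk j k) 2 P
  W_eq_sum : ∀ᵐ ω ∂P, W ω = ∑ j, X j ω
  integral_X : ∀ j, ∫ ω, X j ω ∂P = 0
  integral_W_sq : ∫ ω, W ω ^ 2 ∂P = 1
  W_eq : ∀ j, ∀ᵐ ω ∂P, W ω = Wj j ω + Zj j ω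
  Zj_eq_sum : ∀ j, ∀ᵐ ω ∂P, Zj j ω = ∑ k ∈ N j, Zjk j k ω
  Wj_eq : ∀ j, ∀ k ∈ N j, ∀ᵐ ω ∂P, Wj j ω = Wjk j k ω + Vjk j k ω
  indep_Wj : ∀ j, IndepFun (Wj j) (X j) P
  indep_Wjk : ∀ j, ∀ k ∈ N j, IndepFun (Wjk j k) (fun ω => (X j ω, Zjk j k ω)) P

namespace BKRDecomposition

variable {Ω : Type*} [MeasurableSpace Ω] {P : Measure Ω} {W : Ω → ℝ} {J : Type*} [Fintype J]

/-- The third-moment quantity `A ∈ [0, ∞]`: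
`½ ∑_j E[|X_j| Z_j²] + ∑_j ∑_{k ∈ N_j} (E|X_j Z_{jk} (Z_j + V_{jk})| + E|X_j Z_{jk}| E|Z_j + V_{jk}|)`. -/
def A (D : BKRDecomposition P W J) : ℝ≥0∞ :=
  (1 / 2) * ∑ j, ∫⁻ ω, ‖D.X j ω‖ₑ * ‖D.Zj j ω‖ₑ ^ 2 ∂P
    + ∑ j, ∑ k ∈ D.N j,
        ((∫⁻ ω, ‖D.X j ω * D.Zjk j k ω * (D.Zj j ω + D.Vjk j k ω)‖ₑ ∂P)
          + (∫⁻ ω, ‖D.X j ω * D.Zjk j k ω‖ₑ ∂P) * ∫⁻ ω, ‖D.Zj j ω + D.Vjk j k ω‖ₑ ∂P)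

/-- `∑_j X_j Z_j² R_2(-t Z_j)`. -/
def S₁ (D : BKRDecomposition P W J) (t : ℝ) (ω : Ω) : ℂ :=
  ∑ j, (D.X j ω : ℂ) * (D.Zj j ω : ℂ) ^ 2 * taylorR 2 (-t * D.Zj j ω)

/-- `∑_j ∑_{k ∈ N_j} X_j Z_{jk} (Z_j + V_{jk}) R_1(-t (Z_j + V_{jk}))`. -/
def S₂ (D : BKRDecomposition P W J) (t : ℝ) (ω : Ω) : ℂ :=
  ∑ j, ∑ k ∈ D.N j, (D.X j ω : ℂ) * (D.Zjk j k ω : ℂ) * ((D.Zj j ω : ℂ) + (D.Vjk j k ω : ℂ))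
    * taylorR 1 (-t * (D.Zj j ω + D.Vjk j k ω))

/-- `∑_j ∑_{k ∈ N_j} E[X_j Z_{jk}] (Z_j + V_{jk}) R_1(-t (Z_j + V_{jk}))`. -/
def S₃ (D : BKRDecomposition P W J) (t : ℝ) (ω : Ω) : ℂ :=
  ∑ j, ∑ k ∈ D.N j, ((∫ ω', D.X j ω' * D.Zjk j k ω' ∂P : ℝ) : ℂ)
    * ((D.Zj j ω : ℂ) + (D.Vjk j k ω : ℂ)) * taylorR 1 (-t * (D.Zj j ω + D.Vjk j k ω))

/-- The covariance bound at the parameter `t`: `Var(S₁)^{1/2} + Var(S₂)^{1/2} + Var(S₃)^{1/2}`. -/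
def Bt (D : BKRDecomposition P W J) (t : ℝ) : ℝ≥0∞ :=
  complexEVariance (D.S₁ t) P ^ (1 / 2 : ℝ) + complexEVariance (D.S₂ t) P ^ (1 / 2 : ℝ)
    + complexEVariance (D.S₃ t) P ^ (1 / 2 : ℝ)

/-- The quantity `B ∈ [0, ∞]`: the best bound on `Bt` that is uniform in `t ∈ ℝ`. -/
def B (D : BKRDecomposition P W J) : ℝ≥0∞ :=
  ⨆ t : ℝ, D.Bt t

end BKRDecomposition

end

/-! The proof is Tikhomirov's method: derive a perturbed Gaussian differential equation for the
characteristic function φ of W, solve it near 0, and pass to distribution functions by Esseen's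
inequality.

Start from φ'(t) = i ∑_j E[X_j e^{itW}]. Expanding e^{itW_j} around e^{itW}, to second order in Z_j,
and using E[X_j e^{itW_j}] = 0, leaves it E[X_j Z_j e^{itW}] plus a remainder that sums to S₁. Split
Z_j into the Z_{jk}, replace W by W_{jk}, factor by independence, and return from W_{jk} to W; the
two replacements leave S₂ and S₃. As ∑_j E[X_j Z_j] = E[W²] = 1, this gives φ' = -tφ + i t² E[(S₁ +
S₃ - S₂) e^{itW}] (`hasDerivAt_charFun`).

Every remainder carries the same factor e^{itW}, so E[S e^{itW}] is E[S] φ plus a covariance. The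
means add up to at most A in modulus, and the covariances to at most B by the variance bound. Thus
φ' = -tφ + aφ + b with |a| ≤ A t² and |b| ≤ B t². A Grönwall argument
(`norm_sub_exp_le_of_hasDerivAt`) gives, for 0 ≤ t ≤ 1/(2A), |φ(t) - e^{-t²/2}| ≤ (A t³/3) e^{-t²/4}
+ 2Bt.

Esseen's inequality (`kolmogorovDist_le_of_charFun_sub_le`) with T = 1/(2A) divides this by |t| and
integrates: the first term yields a multiple of A, the second a multiple of BT, hence of B/A, and
the truncation error is of order 1/T, hence of A. -/

/-! ### Taylor remainders of the exponential -/

lemma pow_mul_taylorR (l : ℕ) (z : ℝ) :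
    (Complex.I * z) ^ l * taylorR l z =
      Complex.exp (Complex.I * z) - ∑ i ∈ Finset.range l, (Complex.I * z) ^ i / (i ! : ℂ) := by
  have hs := NormedSpace.expSeries_div_hasSum_exp (𝔸 := ℂ) (Complex.I * z)
  rw [← Complex.exp_eq_exp_ℂ] at hs
  rw [eq_sub_iff_add_eq', ← hs.tsum_eq, ← hs.summable.sum_add_tsum_nat_add l, taylorR,
    ← tsum_mul_left]
  congr 2
  ext m
  rw [pow_add]
  ring

lemma taylorR_zero_right (l : ℕ) : taylorR l 0 = 1 / (l ! : ℂ) := by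
  rw [taylorR, tsum_eq_single 0]
  · simp
  · intro m hm
    simp [hm]

lemma mul_taylorR_one (z : ℝ) :
    Complex.I * z * taylorR 1 z = Complex.exp (Complex.I * z) - 1 := by
  simpa using pow_mul_taylorR 1 z

lemma sq_mul_taylorR_two (z : ℝ) :
    (Complex.I * z) ^ 2 * taylorR 2 z = Complex.exp (Complex.I * z) - 1 - Complex.I * z := by
  simpa [Finset.sum_range_succ, sub_sub] using pow_mul_taylorR 2 z

/-- Along s ∈ [0, 1] the derivative of e^{izs} - 1 - izs is iz(e^{izs} - 1), of norm at most z² s;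
integrating gives the constant 1/2, which becomes the 1/2 in `A`. -/
lemma norm_exp_I_mul_sub_one_sub_le (z : ℝ) :
    ‖Complex.exp (Complex.I * z) - 1 - Complex.I * z‖ ≤ z ^ 2 / 2 := by
  have key := image_norm_le_of_norm_deriv_right_le_deriv_boundary (a := 0) (b := 1)
    (f := fun s : ℝ => Complex.exp (Complex.I * z * s) - 1 - Complex.I * z * s)
    (f' := fun s : ℝ => Complex.I * z * (Complex.exp (Complex.I * z * s) - 1))
    (B := fun s => z ^ 2 / 2 * s ^ 2) (B' := fun s => z ^ 2 * s)
    (by fun_prop) ?_ (by simp) ?_ ?_ (Set.right_mem_Icc.2 zero_le_one)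
  · simpa using key
  · intro s _
    have h0 : HasDerivAt (fun s : ℝ => Complex.I * z * s) (Complex.I * z) s := by
      simpa using (Complex.ofRealCLM.hasDerivAt (x := s)).const_mul (Complex.I * z)
    refine HasDerivAt.hasDerivWithinAt ?_
    convert! (h0.cexp.sub_const 1).sub h0 using 1
    ring
  · intro s
    convert! (hasDerivAt_pow 2 s).const_mul (z ^ 2 / 2) using 1
    simp
    ring
  · intro s hs
    have := Real.norm_exp_I_mul_ofReal_sub_one_le (x := z * s)
    push_cast at this
    rw [norm_mul, mul_assoc Complex.I]
    calc _ ≤ |z| * ‖z * s‖ := by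
          gcongr
          simp
      _ = z ^ 2 * s := by
          rw [Real.norm_eq_abs, abs_mul, abs_of_nonneg hs.1, ← mul_assoc, abs_mul_abs_self, sq]

lemma norm_taylorR_one_le (z : ℝ) : ‖taylorR 1 z‖ ≤ 1 := by
  rcases eq_or_ne z 0 with rfl | hz
  · simp [taylorR_zero_right]
  · have h := congrArg norm (mul_taylorR_one z)
    have h' := Real.norm_exp_I_mul_ofReal_sub_one_le (x := z)
    rw [← h] at h'
    simp only [norm_mul, Complex.norm_I, one_mul, Complex.norm_real] at h'
    have : 0 < ‖z‖ := norm_pos_iff.2 hz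
    nlinarith

lemma norm_taylorR_two_le (z : ℝ) : ‖taylorR 2 z‖ ≤ 1 / 2 := by
  rcases eq_or_ne z 0 with rfl | hz
  · simp [taylorR_zero_right]
  · have h := congrArg norm (sq_mul_taylorR_two z)
    have h' := norm_exp_I_mul_sub_one_sub_le z
    rw [← h] at h'
    simp only [norm_mul, norm_pow, Complex.norm_I, one_mul, Complex.norm_real,
      Real.norm_eq_abs, sq_abs] at h'
    have : 0 < z ^ 2 := by positivity
    nlinarith

/-- Away from 0 the series is a closed-form quotient, and 0 is a single point. -/
lemma measurable_taylorR (l : ℕ) : Measurable (taylorR l) := by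
  have h : taylorR l = fun z : ℝ => if z = 0 then 1 / (l ! : ℂ) else
      (Complex.exp (Complex.I * z) - ∑ i ∈ Finset.range l, (Complex.I * z) ^ i / (i ! : ℂ))
        / (Complex.I * z) ^ l := by
    ext z
    split_ifs with hz
    · rw [hz, taylorR_zero_right]
    · rw [← pow_mul_taylorR, mul_div_cancel_left₀]
      simp [hz]
  rw [h]
  exact Measurable.ite (measurableSet_singleton 0) (by fun_prop) (by fun_prop)

/-! ### A Grönwall estimate for Tikhomirov's differential equation -/

/-- The integrating factor turns the equation into f' = a f + a + e^{t²/2} b for f = e^{t²/2} u - 1.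
The barrier β = (A t³/3) e^{t²/4} + 2Bt e^{t²/2} outgrows |f| at any contact point: since At ≤ 1/2,
the feedback A t² β is at most (A t⁴/6) e^{t²/4} + B t² e^{t²/2}, which β' can pay for. The spare
term 2B e^{t²/2} in β' makes the comparison strict, hence B > 0. -/
lemma norm_sub_exp_le_of_hasDerivAt_of_pos {A B T : ℝ} (hA : 0 ≤ A) (hB : 0 < B)
    (hT : A * T ≤ 1 / 2) {u a b : ℝ → ℂ} (h0 : u 0 = 1)
    (hu : ∀ t, HasDerivAt u (-t * u t + a t * u t + b t) t)
    (ha : ∀ t, ‖a t‖ ≤ A * t ^ 2) (hb : ∀ t, ‖b t‖ ≤ B * t ^ 2) {t : ℝ}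
    (ht : t ∈ Set.Icc 0 T) :
    ‖u t - Real.exp (-t ^ 2 / 2)‖ ≤ A * t ^ 3 / 3 * Real.exp (-t ^ 2 / 4) + 2 * B * t := by
  have hexp : ∀ t : ℝ, HasDerivAt (fun t : ℝ => Real.exp (t ^ 2 / 2))
      (t * Real.exp (t ^ 2 / 2)) t := fun t => by
    convert! ((hasDerivAt_pow 2 t).div_const 2).exp using 1
    simp
    ring
  have hexp4 : ∀ t : ℝ, HasDerivAt (fun t : ℝ => Real.exp (t ^ 2 / 4))
      (t / 2 * Real.exp (t ^ 2 / 4)) t := fun t => by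
    convert! ((hasDerivAt_pow 2 t).div_const 4).exp using 1
    simp
    ring
  have hf : ∀ t : ℝ, HasDerivAt (fun t : ℝ => (Real.exp (t ^ 2 / 2) : ℂ) * u t - 1)
      (Real.exp (t ^ 2 / 2) * (a t * u t + b t)) t := fun t => by
    convert! ((hexp t).ofReal_comp.mul (hu t)).sub_const 1 using 1
    push_cast
    ring
  have key := image_norm_le_of_norm_deriv_right_lt_deriv_boundary (a := 0) (b := T)
    (f := fun t : ℝ => (Real.exp (t ^ 2 / 2) : ℂ) * u t - 1)
    (f' := fun t => Real.exp (t ^ 2 / 2) * (a t * u t + b t))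
    (B := fun t => A * t ^ 3 / 3 * Real.exp (t ^ 2 / 4) + 2 * B * t * Real.exp (t ^ 2 / 2))
    (B' := fun t => (A * t ^ 2 + A * t ^ 4 / 6) * Real.exp (t ^ 2 / 4)
      + 2 * B * (1 + t ^ 2) * Real.exp (t ^ 2 / 2))
    (fun t _ => (hf t).continuousAt.continuousWithinAt) (fun t _ => (hf t).hasDerivWithinAt)
    (by simp [h0]) ?_ ?_ ht
  · have e : u t - Real.exp (-t ^ 2 / 2) =
        Real.exp (-t ^ 2 / 2) * ((Real.exp (t ^ 2 / 2) : ℂ) * u t - 1) := by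
      rw [mul_sub, ← mul_assoc, ← Complex.ofReal_mul, ← Real.exp_add]
      simp [neg_div]
    have e1 : Real.exp (-t ^ 2 / 2) * Real.exp (t ^ 2 / 4) = Real.exp (-t ^ 2 / 4) := by
      rw [← Real.exp_add]
      ring_nf
    have e2 : Real.exp (-t ^ 2 / 2) * Real.exp (t ^ 2 / 2) = 1 := by
      rw [← Real.exp_add]
      simp [neg_div]
    rw [e, norm_mul, Complex.norm_real, Real.norm_of_nonneg (Real.exp_nonneg _)]
    calc _ ≤ Real.exp (-t ^ 2 / 2) * (A * t ^ 3 / 3 * Real.exp (t ^ 2 / 4)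
            + 2 * B * t * Real.exp (t ^ 2 / 2)) := by gcongr
      _ = A * t ^ 3 / 3 * (Real.exp (-t ^ 2 / 2) * Real.exp (t ^ 2 / 4))
            + 2 * B * t * (Real.exp (-t ^ 2 / 2) * Real.exp (t ^ 2 / 2)) := by ring
      _ = _ := by rw [e1, e2, mul_one]
  · intro t
    convert! ((((hasDerivAt_pow 3 t).const_mul A).div_const 3).mul (hexp4 t)).add
      (((hasDerivAt_id t).const_mul (2 * B)).mul (hexp t)) using 1
    simp
    ring
  · intro t ht hft
    have e : (Real.exp (t ^ 2 / 2) : ℂ) * (a t * u t + b t) =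
        a t * ((Real.exp (t ^ 2 / 2) : ℂ) * u t - 1) + a t + Real.exp (t ^ 2 / 2) * b t := by
      ring
    have hAt : A * t ≤ 1 / 2 := (mul_le_mul_of_nonneg_left ht.2.le hA).trans hT
    have ht0 : 0 ≤ t := ht.1
    have E4 : 1 ≤ Real.exp (t ^ 2 / 4) := Real.one_le_exp (by positivity)
    have E2 : 1 ≤ Real.exp (t ^ 2 / 2) := Real.one_le_exp (by positivity)
    set x := Real.exp (t ^ 2 / 4)
    set y := Real.exp (t ^ 2 / 2)
    have n1 : ‖(y : ℂ) * (a t * u t + b t)‖ ≤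
        A * t ^ 2 * (A * t ^ 3 / 3 * x + 2 * B * t * y) + A * t ^ 2 + y * (B * t ^ 2) := by
      rw [e]
      refine (norm_add₃_le).trans ?_
      rw [norm_mul, norm_mul, hft, Complex.norm_real, Real.norm_of_nonneg (by positivity)]
      gcongr
      · exact ha t
      · exact ha t
      · exact hb t
    refine n1.trans_lt ?_
    have i1 : A * t ^ 2 * (A * t ^ 3 / 3 * x) ≤ A * t ^ 4 / 6 * x := by
      have := mul_le_mul_of_nonneg_left hAt (show 0 ≤ A * t ^ 4 / 3 * x by positivity)
      linarith
    have i2 : A * t ^ 2 * (2 * B * t * y) ≤ B * t ^ 2 * y := by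
      have := mul_le_mul_of_nonneg_left hAt (show 0 ≤ 2 * B * t ^ 2 * y by positivity)
      linarith
    have i3 : A * t ^ 2 ≤ A * t ^ 2 * x := le_mul_of_one_le_right (by positivity) E4
    have i4 : 0 < 2 * B * y := by positivity
    linarith

/-- If `u' = -t u + a u + b` with `‖a t‖ ≤ A t²` and `‖b t‖ ≤ B t²`, then `u` is close to
`exp (-t² / 2)` for `0 ≤ t ≤ 1 / (2 A)`. -/
lemma norm_sub_exp_le_of_hasDerivAt {A B T : ℝ} (hA : 0 ≤ A) (hB : 0 ≤ B)
    (hT : A * T ≤ 1 / 2) {u a b : ℝ → ℂ} (h0 : u 0 = 1)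
    (hu : ∀ t, HasDerivAt u (-t * u t + a t * u t + b t) t)
    (ha : ∀ t, ‖a t‖ ≤ A * t ^ 2) (hb : ∀ t, ‖b t‖ ≤ B * t ^ 2) {t : ℝ}
    (ht : t ∈ Set.Icc 0 T) :
    ‖u t - Real.exp (-t ^ 2 / 2)‖ ≤ A * t ^ 3 / 3 * Real.exp (-t ^ 2 / 4) + 2 * B * t := by
  -- The strict comparison needs a positive constant, so it is applied with B + ε, and ε tends to 0
  -- from the right.
  have hlim : Filter.Tendsto
      (fun ε : ℝ => A * t ^ 3 / 3 * Real.exp (-t ^ 2 / 4) + 2 * (B + ε) * t)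
      (nhdsWithin 0 (Set.Ioi 0))
      (nhds (A * t ^ 3 / 3 * Real.exp (-t ^ 2 / 4) + 2 * (B + 0) * t)) :=
    (Continuous.tendsto (by fun_prop) 0).mono_left nhdsWithin_le_nhds
  rw [add_zero] at hlim
  refine ge_of_tendsto hlim ?_
  filter_upwards [self_mem_nhdsWithin] with ε hε
  have hε : 0 < ε := hε
  refine norm_sub_exp_le_of_hasDerivAt_of_pos hA (by positivity) hT h0 hu ha (fun s => ?_) ht
  exact (hb s).trans (by gcongr; linarith)

/-! ### Covariances and variances -/

lemma enorm_complex_ofReal (x : ℝ) : ‖(x : ℂ)‖ₑ = ‖x‖ₑ := by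
  rw [← ofReal_norm, ← ofReal_norm, Complex.norm_real]

lemma MeasureTheory.MemLp.integrable_fun_mul {Ω : Type*} [MeasurableSpace Ω] {P : Measure Ω}
    {X Y : Ω → ℝ} (hX : MemLp X 2 P) (hY : MemLp Y 2 P) : Integrable (fun ω => X ω * Y ω) P :=
  hX.integrable_mul hY

/-- The covariance is E[(S - E S) e]; drop e by |e| ≤ 1 and pass from the L¹ to the L² norm. Square
integrability of S is not needed, since the right side may be infinite. -/
lemma enorm_integral_mul_sub_le {Ω : Type*} [MeasurableSpace Ω] {P : Measure Ω}
    [IsProbabilityMeasure P] {S e : Ω → ℂ} (hS : Integrable S P) (he : AEStronglyMeasurable e P)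
    (he1 : ∀ ω, ‖e ω‖ ≤ 1) :
    ‖∫ ω, S ω * e ω ∂P - (∫ ω, S ω ∂P) * ∫ ω, e ω ∂P‖ₑ ≤ complexEVariance S P ^ (1 / 2 : ℝ) := by
  have hSe : Integrable (fun ω => S ω * e ω) P :=
    hS.mul_bdd (c := 1) he (Filter.Eventually.of_forall he1)
  have hie : Integrable e P :=
    Integrable.of_bound he 1 (Filter.Eventually.of_forall he1)
  have h1 : ∫ ω, S ω * e ω ∂P - (∫ ω, S ω ∂P) * ∫ ω, e ω ∂P =
      ∫ ω, (S ω - ∫ ω', S ω' ∂P) * e ω ∂P := by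
    simp_rw [sub_mul]
    rw [integral_sub hSe (hie.const_mul _), integral_const_mul]
  have hm : AEStronglyMeasurable (fun ω => S ω - ∫ ω', S ω' ∂P) P :=
    hS.aestronglyMeasurable.sub aestronglyMeasurable_const
  rw [h1]
  calc _ ≤ ∫⁻ ω, ‖(S ω - ∫ ω', S ω' ∂P) * e ω‖ₑ ∂P := enorm_integral_le_lintegral_enorm _
    _ ≤ ∫⁻ ω, ‖S ω - ∫ ω', S ω' ∂P‖ₑ ∂P := by
        refine lintegral_mono fun ω => ?_
        rw [enorm_mul]
        refine mul_le_of_le_one_right' ?_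
        rw [← ofReal_norm]
        exact ENNReal.ofReal_le_one.2 (he1 ω)
    _ ≤ eLpNorm (fun ω => S ω - ∫ ω', S ω' ∂P) 2 P := by
        rw [← eLpNorm_one_eq_lintegral_enorm]
        exact eLpNorm_le_eLpNorm_of_exponent_le (by norm_num) hm
    _ = _ := by
        rw [eLpNorm_eq_lintegral_rpow_enorm_toReal (by norm_num) (by norm_num), complexEVariance]
        simp

/-! ### Second-moment normalisation and positivity of `A` -/

namespace BKRDecomposition

variable {Ω : Type*} [MeasurableSpace Ω] {P : Measure Ω} {W : Ω → ℝ} {J : Type*} [Fintype J]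

lemma memLp_Zj_add_Vjk (D : BKRDecomposition P W J) (j k : J) (hk : k ∈ D.N j) :
    MemLp (fun ω => D.Zj j ω + D.Vjk j k ω) 2 P :=
  (D.memLp_Zj j).add (D.memLp_Vjk j k hk)

lemma sum_integral_X_mul_Zjk (D : BKRDecomposition P W J) (j : J) :
    ∑ k ∈ D.N j, ∫ ω, D.X j ω * D.Zjk j k ω ∂P = ∫ ω, D.X j ω * D.Zj j ω ∂P := by
  rw [← integral_finsetSum _ fun k hk => (D.memLp_X j).integrable_fun_mul (D.memLp_Zjk j k hk)]
  refine integral_congr_ae ?_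
  filter_upwards [D.Zj_eq_sum j] with ω h
  rw [h, Finset.mul_sum]

/-- Independence and centring give E[X_j W_j] = 0, so E[X_j Z_j] = E[X_j W], and these sum to E[W²].
This is what makes the main coefficient of the differential equation exactly -t. -/
lemma sum_integral_X_mul_Zj (D : BKRDecomposition P W J) :
    ∑ j, ∫ ω, D.X j ω * D.Zj j ω ∂P = 1 := by
  have h (j : J) : ∫ ω, D.X j ω * D.Zj j ω ∂P = ∫ ω, D.X j ω * W ω ∂P := by
    have h1 : ∫ ω, D.X j ω * W ω ∂P =
        ∫ ω, D.X j ω * D.Wj j ω + D.X j ω * D.Zj j ω ∂P := by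
      refine integral_congr_ae ?_
      filter_upwards [D.W_eq j] with ω h
      rw [h, mul_add]
    have h2 := (D.indep_Wj j).symm.integral_fun_mul_eq_mul_integral
      (D.memLp_X j).aestronglyMeasurable (D.memLp_Wj j).aestronglyMeasurable
    rw [h1, integral_add ((D.memLp_X j).integrable_fun_mul (D.memLp_Wj j))
      ((D.memLp_X j).integrable_fun_mul (D.memLp_Zj j)), h2, D.integral_X]
    simp
  simp_rw [h]
  rw [← integral_finsetSum _ fun j _ => (D.memLp_X j).integrable_fun_mul D.memLp_W,
    ← D.integral_W_sq]
  refine integral_congr_ae ?_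
  filter_upwards [D.W_eq_sum] with ω h
  rw [← Finset.sum_mul, ← h, sq]

/-- If `A` vanished, every X_j Z_j² and hence every X_j Z_j would be zero almost surely,
contradicting ∑_j E[X_j Z_j] = 1. -/
lemma A_pos (D : BKRDecomposition P W J) : 0 < D.A := by
  rw [pos_iff_ne_zero]
  intro h0
  have h1 : ∀ j, ∫⁻ ω, ‖D.X j ω‖ₑ * ‖D.Zj j ω‖ₑ ^ 2 ∂P = 0 := by
    have := (add_eq_zero.1 h0).1
    simpa using this
  have h2 : ∀ j, ∫ ω, D.X j ω * D.Zj j ω ∂P = 0 := by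
    intro j
    rw [integral_eq_zero_of_ae]
    have hX := (D.memLp_X j).aestronglyMeasurable.enorm
    have hZ := (D.memLp_Zj j).aestronglyMeasurable.enorm
    have := (lintegral_eq_zero_iff' (by fun_prop)).1 (h1 j)
    filter_upwards [this] with ω hω
    simpa using hω
  have := D.sum_integral_X_mul_Zj
  simp [h2] at this

/-! ### First absolute moments of `S₁`, `S₂`, `S₃` -/

section Moments

variable (D : BKRDecomposition P W J) (t : ℝ)

lemma aestronglyMeasurable_taylorR_Zj (l : ℕ) (j : J) :
    AEStronglyMeasurable (fun ω => taylorR l (-t * D.Zj j ω)) P :=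
  ((measurable_taylorR l).comp_aemeasurable
    ((D.memLp_Zj j).aestronglyMeasurable.aemeasurable.const_mul (-t))).aestronglyMeasurable

lemma aestronglyMeasurable_taylorR_Zj_add_Vjk (l : ℕ) (j k : J) (hk : k ∈ D.N j) :
    AEStronglyMeasurable (fun ω => taylorR l (-t * (D.Zj j ω + D.Vjk j k ω))) P :=
  ((measurable_taylorR l).comp_aemeasurable
    ((D.memLp_Zj_add_Vjk j k hk).aestronglyMeasurable.aemeasurable.const_mul
      (-t))).aestronglyMeasurable

lemma aestronglyMeasurable_S₁_term (j : J) :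
    AEStronglyMeasurable (fun ω => (D.X j ω : ℂ) * (D.Zj j ω : ℂ) ^ 2
      * taylorR 2 (-t * D.Zj j ω)) P := by
  have h1 := Complex.continuous_ofReal.comp_aestronglyMeasurable
    (D.memLp_X j).aestronglyMeasurable
  have h2 := Complex.continuous_ofReal.comp_aestronglyMeasurable
    (D.memLp_Zj j).aestronglyMeasurable
  exact (h1.mul (h2.pow 2)).mul (D.aestronglyMeasurable_taylorR_Zj t 2 j)

lemma aestronglyMeasurable_S₂_term (j k : J) (hk : k ∈ D.N j) :
    AEStronglyMeasurable (fun ω => (D.X j ω : ℂ) * (D.Zjk j k ω : ℂ)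
      * ((D.Zj j ω : ℂ) + (D.Vjk j k ω : ℂ)) * taylorR 1 (-t * (D.Zj j ω + D.Vjk j k ω))) P := by
  have h1 := Complex.continuous_ofReal.comp_aestronglyMeasurable
    (D.memLp_X j).aestronglyMeasurable
  have h2 := Complex.continuous_ofReal.comp_aestronglyMeasurable
    (D.memLp_Zj j).aestronglyMeasurable
  have h3 := Complex.continuous_ofReal.comp_aestronglyMeasurable
    (D.memLp_Zjk j k hk).aestronglyMeasurable
  have h4 := Complex.continuous_ofReal.comp_aestronglyMeasurable
    (D.memLp_Vjk j k hk).aestronglyMeasurable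
  exact ((h1.mul h3).mul (h2.add h4)).mul (D.aestronglyMeasurable_taylorR_Zj_add_Vjk t 1 j k hk)

lemma aestronglyMeasurable_S₃_term (c : ℂ) (j k : J) (hk : k ∈ D.N j) :
    AEStronglyMeasurable (fun ω => c
      * ((D.Zj j ω : ℂ) + (D.Vjk j k ω : ℂ)) * taylorR 1 (-t * (D.Zj j ω + D.Vjk j k ω))) P := by
  have h2 := Complex.continuous_ofReal.comp_aestronglyMeasurable
    (D.memLp_Zj j).aestronglyMeasurable
  have h4 := Complex.continuous_ofReal.comp_aestronglyMeasurable
    (D.memLp_Vjk j k hk).aestronglyMeasurable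
  exact ((h2.add h4).const_mul c).mul (D.aestronglyMeasurable_taylorR_Zj_add_Vjk t 1 j k hk)

lemma enorm_taylorR_one_le (z : ℝ) : ‖taylorR 1 z‖ₑ ≤ 1 := by
  rw [← ofReal_norm]
  exact ENNReal.ofReal_le_one.2 (norm_taylorR_one_le z)

lemma enorm_taylorR_two_le (z : ℝ) : ‖taylorR 2 z‖ₑ ≤ 1 / 2 := by
  rw [← ofReal_norm]
  refine (ENNReal.ofReal_le_ofReal (norm_taylorR_two_le z)).trans_eq ?_
  rw [ENNReal.ofReal_div_of_pos (by norm_num)]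
  simp

lemma lintegral_enorm_S₁_term_le (j : J) :
    ∫⁻ ω, ‖(D.X j ω : ℂ) * (D.Zj j ω : ℂ) ^ 2 * taylorR 2 (-t * D.Zj j ω)‖ₑ ∂P ≤
      1 / 2 * ∫⁻ ω, ‖D.X j ω‖ₑ * ‖D.Zj j ω‖ₑ ^ 2 ∂P := by
  rw [← lintegral_const_mul' _ _ (by simp)]
  refine lintegral_mono fun ω => ?_
  rw [enorm_mul, mul_comm (1 / 2 : ℝ≥0∞)]
  gcongr
  · rw [enorm_mul, enorm_pow, enorm_complex_ofReal, enorm_complex_ofReal]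
  · exact enorm_taylorR_two_le _

lemma lintegral_enorm_S₂_term_le (j k : J) :
    ∫⁻ ω, ‖(D.X j ω : ℂ) * (D.Zjk j k ω : ℂ) * ((D.Zj j ω : ℂ) + (D.Vjk j k ω : ℂ))
      * taylorR 1 (-t * (D.Zj j ω + D.Vjk j k ω))‖ₑ ∂P ≤
      ∫⁻ ω, ‖D.X j ω * D.Zjk j k ω * (D.Zj j ω + D.Vjk j k ω)‖ₑ ∂P := by
  refine lintegral_mono fun ω => ?_
  rw [enorm_mul]
  refine (mul_le_of_le_one_right' (enorm_taylorR_one_le _)).trans_eq ?_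
  rw [← Complex.ofReal_add, ← Complex.ofReal_mul, ← Complex.ofReal_mul, enorm_complex_ofReal]

lemma lintegral_enorm_S₃_term_le (j k : J) :
    ∫⁻ ω, ‖((∫ ω', D.X j ω' * D.Zjk j k ω' ∂P : ℝ) : ℂ)
      * ((D.Zj j ω : ℂ) + (D.Vjk j k ω : ℂ)) * taylorR 1 (-t * (D.Zj j ω + D.Vjk j k ω))‖ₑ ∂P ≤
      (∫⁻ ω, ‖D.X j ω * D.Zjk j k ω‖ₑ ∂P) * ∫⁻ ω, ‖D.Zj j ω + D.Vjk j k ω‖ₑ ∂P := by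
  refine le_trans ?_ (mul_le_mul_left (enorm_integral_le_lintegral_enorm _) _)
  rw [← lintegral_const_mul' _ _ (by simp)]
  refine lintegral_mono fun ω => ?_
  rw [enorm_mul]
  refine (mul_le_of_le_one_right' (enorm_taylorR_one_le _)).trans_eq ?_
  rw [← Complex.ofReal_add, enorm_mul, enorm_complex_ofReal, enorm_complex_ofReal]

variable {D}

lemma integrable_S₁_term (hA : D.A ≠ ∞) (j : J) :
    Integrable (fun ω => (D.X j ω : ℂ) * (D.Zj j ω : ℂ) ^ 2 * taylorR 2 (-t * D.Zj j ω)) P := by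
  refine ⟨D.aestronglyMeasurable_S₁_term t j, ?_⟩
  refine (D.lintegral_enorm_S₁_term_le t j).trans_lt ?_
  refine lt_of_le_of_lt ?_ hA.lt_top
  refine le_trans ?_ (le_self_add)
  gcongr
  exact Finset.single_le_sum (f := fun j => ∫⁻ ω, ‖D.X j ω‖ₑ * ‖D.Zj j ω‖ₑ ^ 2 ∂P)
    (fun _ _ => zero_le) (Finset.mem_univ j)

lemma term_le_A (D : BKRDecomposition P W J) (j k : J) (hk : k ∈ D.N j) :
    (∫⁻ ω, ‖D.X j ω * D.Zjk j k ω * (D.Zj j ω + D.Vjk j k ω)‖ₑ ∂P)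
      + (∫⁻ ω, ‖D.X j ω * D.Zjk j k ω‖ₑ ∂P) * ∫⁻ ω, ‖D.Zj j ω + D.Vjk j k ω‖ₑ ∂P ≤ D.A := by
  refine le_trans ?_ le_add_self
  refine le_trans ?_ (Finset.single_le_sum (fun _ _ => zero_le) (Finset.mem_univ j))
  exact Finset.single_le_sum (f := fun k =>
    (∫⁻ ω, ‖D.X j ω * D.Zjk j k ω * (D.Zj j ω + D.Vjk j k ω)‖ₑ ∂P)
      + (∫⁻ ω, ‖D.X j ω * D.Zjk j k ω‖ₑ ∂P) * ∫⁻ ω, ‖D.Zj j ω + D.Vjk j k ω‖ₑ ∂P)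
    (fun _ _ => zero_le) hk

lemma integrable_S₂_term (hA : D.A ≠ ∞) (j k : J) (hk : k ∈ D.N j) :
    Integrable (fun ω => (D.X j ω : ℂ) * (D.Zjk j k ω : ℂ)
      * ((D.Zj j ω : ℂ) + (D.Vjk j k ω : ℂ)) * taylorR 1 (-t * (D.Zj j ω + D.Vjk j k ω))) P :=
  ⟨D.aestronglyMeasurable_S₂_term t j k hk, (D.lintegral_enorm_S₂_term_le t j k).trans_lt
    ((le_self_add.trans (D.term_le_A j k hk)).trans_lt hA.lt_top)⟩

lemma integrable_S₃_term (hA : D.A ≠ ∞) (j k : J) (hk : k ∈ D.N j) :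
    Integrable (fun ω => ((∫ ω', D.X j ω' * D.Zjk j k ω' ∂P : ℝ) : ℂ)
      * ((D.Zj j ω : ℂ) + (D.Vjk j k ω : ℂ)) * taylorR 1 (-t * (D.Zj j ω + D.Vjk j k ω))) P :=
  ⟨D.aestronglyMeasurable_S₃_term t _ j k hk, (D.lintegral_enorm_S₃_term_le t j k).trans_lt
    ((le_add_self.trans (D.term_le_A j k hk)).trans_lt hA.lt_top)⟩

lemma integrable_S₁ (hA : D.A ≠ ∞) : Integrable (D.S₁ t) P :=
  integrable_finsetSum _ fun j _ => integrable_S₁_term t hA j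

lemma integrable_S₂ (hA : D.A ≠ ∞) : Integrable (D.S₂ t) P :=
  integrable_finsetSum _ fun j _ => integrable_finsetSum _ fun k hk =>
    integrable_S₂_term t hA j k hk

lemma integrable_S₃ (hA : D.A ≠ ∞) : Integrable (D.S₃ t) P :=
  integrable_finsetSum _ fun j _ => integrable_finsetSum _ fun k hk =>
    integrable_S₃_term t hA j k hk

variable (D)

lemma sum_enorm_integral_le_A (hA : D.A ≠ ∞) :
    ‖∫ ω, D.S₁ t ω ∂P‖ₑ + ‖∫ ω, D.S₂ t ω ∂P‖ₑ + ‖∫ ω, D.S₃ t ω ∂P‖ₑ ≤ D.A := by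
  rw [A, add_assoc]
  simp_rw [Finset.sum_add_distrib]
  gcongr
  · simp_rw [S₁]
    rw [integral_finsetSum _ fun j _ => integrable_S₁_term t hA j, Finset.mul_sum]
    refine (enorm_sum_le _ _).trans (Finset.sum_le_sum fun j _ => ?_)
    exact (enorm_integral_le_lintegral_enorm _).trans (D.lintegral_enorm_S₁_term_le t j)
  · simp_rw [S₂]
    rw [integral_finsetSum _ fun j _ => integrable_finsetSum _ fun k hk =>
      integrable_S₂_term t hA j k hk]
    refine (enorm_sum_le _ _).trans (Finset.sum_le_sum fun j _ => ?_)
    rw [integral_finsetSum _ fun k hk => integrable_S₂_term t hA j k hk]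
    refine (enorm_sum_le _ _).trans (Finset.sum_le_sum fun k _ => ?_)
    exact (enorm_integral_le_lintegral_enorm _).trans (D.lintegral_enorm_S₂_term_le t j k)
  · simp_rw [S₃]
    rw [integral_finsetSum _ fun j _ => integrable_finsetSum _ fun k hk =>
      integrable_S₃_term t hA j k hk]
    refine (enorm_sum_le _ _).trans (Finset.sum_le_sum fun j _ => ?_)
    rw [integral_finsetSum _ fun k hk => integrable_S₃_term t hA j k hk]
    refine (enorm_sum_le _ _).trans (Finset.sum_le_sum fun k _ => ?_)
    exact (enorm_integral_le_lintegral_enorm _).trans (D.lintegral_enorm_S₃_term_le t j k)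

end Moments

end BKRDecomposition

/-! ### Tikhomirov's differential equation for the characteristic function -/

lemma IsProbabilityMeasure.hasDerivAt_charFun {μ : Measure ℝ} [IsProbabilityMeasure μ]
    (h : MemLp id 1 μ) (t : ℝ) :
    HasDerivAt (charFun μ) (Complex.I * ∫ x, x * Complex.exp (Complex.I * (t * x : ℝ)) ∂μ) t := by
  have h' : MemLp id (1 : ℕ) μ := by simpa using h
  have hd : DifferentiableAt ℝ (charFun μ) t :=
    ((contDiff_charFun h').differentiable (by simp)).differentiableAt
  have := iteratedDeriv_charFun h' (t := t)
  rw [iteratedDeriv_one] at this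
  convert! hd.hasDerivAt using 1
  rw [this]
  simp [mul_comm]

namespace BKRDecomposition

/-- The random variable `exp (i t Y)`. -/
noncomputable def expI {Ω : Type*} (Y : Ω → ℝ) (t : ℝ) (ω : Ω) : ℂ :=
  Complex.exp (Complex.I * (t * Y ω : ℝ))

lemma norm_expI {Ω : Type*} (Y : Ω → ℝ) (t : ℝ) (ω : Ω) : ‖expI Y t ω‖ = 1 :=
  Complex.norm_exp_I_mul_ofReal _

variable {Ω : Type*} [MeasurableSpace Ω] {P : Measure Ω} {W : Ω → ℝ} {J : Type*} [Fintype J]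

lemma aestronglyMeasurable_expI {Y : Ω → ℝ} (hY : AEStronglyMeasurable Y P) (t : ℝ) :
    AEStronglyMeasurable (expI Y t) P :=
  (show Continuous fun y : ℝ => Complex.exp (Complex.I * (t * y : ℝ)) by
    fun_prop).comp_aestronglyMeasurable hY

lemma integrable_mul_expI {f : Ω → ℂ} {Y : Ω → ℝ} (hf : Integrable f P)
    (hY : AEStronglyMeasurable Y P) (t : ℝ) : Integrable (fun ω => f ω * expI Y t ω) P :=
  hf.mul_bdd (c := 1) (aestronglyMeasurable_expI hY t)
    (Filter.Eventually.of_forall fun ω => (norm_expI Y t ω).le)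

lemma integrable_ofReal_mul_expI {f : Ω → ℝ} {Y : Ω → ℝ} (hf : Integrable f P)
    (hY : AEStronglyMeasurable Y P) (t : ℝ) : Integrable (fun ω => (f ω : ℂ) * expI Y t ω) P :=
  integrable_mul_expI hf.ofReal hY t

lemma integral_mul_expI_of_indepFun {f Y : Ω → ℝ} (h : IndepFun Y f P)
    (hf : AEStronglyMeasurable f P) (hY : AEStronglyMeasurable Y P) (t : ℝ) :
    ∫ ω, (f ω : ℂ) * expI Y t ω ∂P = (∫ ω, f ω ∂P : ℝ) * ∫ ω, expI Y t ω ∂P := by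
  rw [← integral_complex_ofReal]
  exact h.symm.integral_fun_comp_mul_comp (f := fun x : ℝ => (x : ℂ))
    (g := fun y : ℝ => Complex.exp (Complex.I * (t * y : ℝ)))
    hf.aemeasurable hY.aemeasurable (by fun_prop) (by fun_prop)

/-- The expansion is made around W, not around W_j, so that the remainder carries e^{itW}; only then
can it later be split into a mean times φ and a covariance with e^{itW}. -/
lemma expI_first (D : BKRDecomposition P W J) (t : ℝ) (j : J) :
    ∀ᵐ ω ∂P, (D.X j ω : ℂ) * expI W t ω = D.X j ω * expI (D.Wj j) t ω
      + Complex.I * t * (((D.X j ω * D.Zj j ω : ℝ) : ℂ) * expI W t ω)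
      + t ^ 2 * ((D.X j ω : ℂ) * (D.Zj j ω : ℂ) ^ 2 * taylorR 2 (-t * D.Zj j ω) * expI W t ω) := by
  filter_upwards [D.W_eq j] with ω h
  have e1 : expI (D.Wj j) t ω = expI W t ω * Complex.exp (Complex.I * (-t * D.Zj j ω : ℝ)) := by
    rw [expI, expI, ← Complex.exp_add, h]
    push_cast
    ring_nf
  have e2 := sq_mul_taylorR_two (-t * D.Zj j ω)
  rw [mul_pow, Complex.I_sq] at e2
  rw [e1, eq_add_of_sub_eq (eq_add_of_sub_eq e2.symm)]
  push_cast
  ring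

lemma expI_second (D : BKRDecomposition P W J) (t : ℝ) (j k : J) (hk : k ∈ D.N j) :
    ∀ᵐ ω ∂P, expI (D.Wjk j k) t ω = expI W t ω
      - Complex.I * t * (((D.Zj j ω : ℂ) + (D.Vjk j k ω : ℂ))
        * taylorR 1 (-t * (D.Zj j ω + D.Vjk j k ω)) * expI W t ω) := by
  filter_upwards [D.W_eq j, D.Wj_eq j k hk] with ω h h'
  have e1 : expI (D.Wjk j k) t ω =
      expI W t ω * Complex.exp (Complex.I * (-t * (D.Zj j ω + D.Vjk j k ω) : ℝ)) := by
    rw [expI, expI, ← Complex.exp_add, h, h']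
    push_cast
    ring_nf
  have e2 := mul_taylorR_one (-t * (D.Zj j ω + D.Vjk j k ω))
  rw [e1, eq_add_of_sub_eq e2.symm]
  push_cast
  ring

lemma charFun_map_eq_integral_expI (hW : AEStronglyMeasurable W P) (t : ℝ) :
    charFun (P.map W) t = ∫ ω, expI W t ω ∂P := by
  rw [charFun_apply_real, integral_map hW.aemeasurable (by fun_prop)]
  simp [expI, mul_comm]

variable [IsProbabilityMeasure P]

lemma integral_X_mul_expI (D : BKRDecomposition P W J) (hA : D.A ≠ ∞) (t : ℝ) (j : J) :
    ∫ ω, (D.X j ω : ℂ) * expI W t ω ∂P =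
      Complex.I * t * ∫ ω, ((D.X j ω * D.Zj j ω : ℝ) : ℂ) * expI W t ω ∂P
      + t ^ 2 * ∫ ω, (D.X j ω : ℂ) * (D.Zj j ω : ℂ) ^ 2 * taylorR 2 (-t * D.Zj j ω)
        * expI W t ω ∂P := by
  have hW := D.memLp_W.aestronglyMeasurable
  have i1 := integrable_ofReal_mul_expI ((D.memLp_X j).integrable (by norm_num))
    (D.memLp_Wj j).aestronglyMeasurable t
  have i2 := (integrable_ofReal_mul_expI
    ((D.memLp_X j).integrable_fun_mul (D.memLp_Zj j)) hW t).const_mul (Complex.I * t)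
  have i3 := (integrable_mul_expI (integrable_S₁_term t hA j) hW t).const_mul ((t : ℂ) ^ 2)
  have i12 : Integrable (fun ω => (D.X j ω : ℂ) * expI (D.Wj j) t ω
      + Complex.I * t * (((D.X j ω * D.Zj j ω : ℝ) : ℂ) * expI W t ω)) P := i1.add i2
  rw [integral_congr_ae (D.expI_first t j), integral_add i12 i3, integral_add i1 i2,
    integral_mul_expI_of_indepFun (D.indep_Wj j) (D.memLp_X j).aestronglyMeasurable
      (D.memLp_Wj j).aestronglyMeasurable, D.integral_X, integral_const_mul, integral_const_mul]
  simp

/-- `expI_second` is used twice: to pass from W to W_{jk} before factoring by independence (the S₂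
term), and to return from E[e^{itW_{jk}}] to E[e^{itW}] afterwards (the S₃ term, with the opposite
sign). -/
lemma integral_X_mul_Zjk_mul_expI (D : BKRDecomposition P W J) (hA : D.A ≠ ∞) (t : ℝ) (j k : J)
    (hk : k ∈ D.N j) :
    ∫ ω, ((D.X j ω * D.Zjk j k ω : ℝ) : ℂ) * expI W t ω ∂P =
      (∫ ω, D.X j ω * D.Zjk j k ω ∂P : ℝ) * ∫ ω, expI W t ω ∂P
      + Complex.I * t * (∫ ω, (D.X j ω : ℂ) * (D.Zjk j k ω : ℂ)
        * ((D.Zj j ω : ℂ) + (D.Vjk j k ω : ℂ)) * taylorR 1 (-t * (D.Zj j ω + D.Vjk j k ω))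
        * expI W t ω ∂P)
      - Complex.I * t * (∫ ω, ((∫ ω', D.X j ω' * D.Zjk j k ω' ∂P : ℝ) : ℂ)
        * ((D.Zj j ω : ℂ) + (D.Vjk j k ω : ℂ)) * taylorR 1 (-t * (D.Zj j ω + D.Vjk j k ω))
        * expI W t ω ∂P) := by
  have hW := D.memLp_W.aestronglyMeasurable
  have hXZ := (D.memLp_X j).integrable_fun_mul (D.memLp_Zjk j k hk)
  have hind : IndepFun (D.Wjk j k) (fun ω => D.X j ω * D.Zjk j k ω) P :=
    (D.indep_Wjk j k hk).comp measurable_id (measurable_fst.mul measurable_snd)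
  have hWjk := (D.memLp_Wjk j k hk).aestronglyMeasurable
  have i0 := integrable_ofReal_mul_expI hXZ hWjk t
  have i1 := (integrable_mul_expI (integrable_S₂_term t hA j k hk) hW t).const_mul (Complex.I * t)
  have i2 := (integrable_mul_expI (integrable_S₃_term t hA j k hk) hW t).const_mul (Complex.I * t)
  have h1 : ∫ ω, ((D.X j ω * D.Zjk j k ω : ℝ) : ℂ) * expI W t ω ∂P =
      ∫ ω, ((D.X j ω * D.Zjk j k ω : ℝ) : ℂ) * expI (D.Wjk j k) t ω + Complex.I * t *
        ((D.X j ω : ℂ) * (D.Zjk j k ω : ℂ)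
        * ((D.Zj j ω : ℂ) + (D.Vjk j k ω : ℂ)) * taylorR 1 (-t * (D.Zj j ω + D.Vjk j k ω))
        * expI W t ω) ∂P := by
    refine integral_congr_ae ?_
    filter_upwards [D.expI_second t j k hk] with ω h
    rw [h]
    push_cast
    ring
  have i3 : Integrable (expI W t) P := by
    simpa using integrable_mul_expI (integrable_const (1 : ℂ)) hW t
  have h2 : (∫ ω, D.X j ω * D.Zjk j k ω ∂P : ℝ) * ∫ ω, expI (D.Wjk j k) t ω ∂P =
      ∫ ω, ((∫ ω', D.X j ω' * D.Zjk j k ω' ∂P : ℝ) : ℂ) * expI W t ω - Complex.I * t *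
        (((∫ ω', D.X j ω' * D.Zjk j k ω' ∂P : ℝ) : ℂ)
        * ((D.Zj j ω : ℂ) + (D.Vjk j k ω : ℂ)) * taylorR 1 (-t * (D.Zj j ω + D.Vjk j k ω))
        * expI W t ω) ∂P := by
    rw [← integral_const_mul]
    refine integral_congr_ae ?_
    filter_upwards [D.expI_second t j k hk] with ω h
    rw [h]
    ring
  rw [h1, integral_add i0 i1, integral_mul_expI_of_indepFun hind hXZ.aestronglyMeasurable hWjk, h2,
    integral_sub (i3.const_mul _) i2]
  simp_rw [integral_const_mul]
  ring

lemma integral_W_mul_expI (D : BKRDecomposition P W J) (hA : D.A ≠ ∞) (t : ℝ) :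
    ∫ ω, (W ω : ℂ) * expI W t ω ∂P =
      Complex.I * t * ∫ ω, expI W t ω ∂P
      + t ^ 2 * (∫ ω, D.S₁ t ω * expI W t ω ∂P + ∫ ω, D.S₃ t ω * expI W t ω ∂P
        - ∫ ω, D.S₂ t ω * expI W t ω ∂P) := by
  have hW := D.memLp_W.aestronglyMeasurable
  have h0 : ∫ ω, (W ω : ℂ) * expI W t ω ∂P = ∑ j, ∫ ω, (D.X j ω : ℂ) * expI W t ω ∂P := by
    rw [← integral_finsetSum _ fun j _ => integrable_ofReal_mul_expI
      ((D.memLp_X j).integrable (by norm_num)) hW t]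
    refine integral_congr_ae ?_
    filter_upwards [D.W_eq_sum] with ω h
    rw [← Finset.sum_mul, h, Complex.ofReal_sum]
  have hZ (j : J) : ∫ ω, ((D.X j ω * D.Zj j ω : ℝ) : ℂ) * expI W t ω ∂P =
      ∑ k ∈ D.N j, ∫ ω, ((D.X j ω * D.Zjk j k ω : ℝ) : ℂ) * expI W t ω ∂P := by
    rw [← integral_finsetSum _ fun k hk => integrable_ofReal_mul_expI
      ((D.memLp_X j).integrable_fun_mul (D.memLp_Zjk j k hk)) hW t]
    refine integral_congr_ae ?_
    filter_upwards [D.Zj_eq_sum j] with ω h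
    rw [← Finset.sum_mul, h, Finset.mul_sum, Complex.ofReal_sum]
  have hS1 : ∫ ω, D.S₁ t ω * expI W t ω ∂P = ∑ j, ∫ ω, (D.X j ω : ℂ) * (D.Zj j ω : ℂ) ^ 2
      * taylorR 2 (-t * D.Zj j ω) * expI W t ω ∂P := by
    rw [← integral_finsetSum _ fun j _ => integrable_mul_expI (integrable_S₁_term t hA j) hW t]
    simp_rw [S₁, Finset.sum_mul]
  have hS2 : ∫ ω, D.S₂ t ω * expI W t ω ∂P = ∑ j, ∑ k ∈ D.N j,
      ∫ ω, (D.X j ω : ℂ) * (D.Zjk j k ω : ℂ)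
        * ((D.Zj j ω : ℂ) + (D.Vjk j k ω : ℂ)) * taylorR 1 (-t * (D.Zj j ω + D.Vjk j k ω))
        * expI W t ω ∂P := by
    simp_rw [S₂, Finset.sum_mul]
    rw [integral_finsetSum _ fun j _ => integrable_finsetSum _ fun k hk =>
      integrable_mul_expI (integrable_S₂_term t hA j k hk) hW t]
    refine Finset.sum_congr rfl fun j _ => ?_
    rw [integral_finsetSum _ fun k hk =>
      integrable_mul_expI (integrable_S₂_term t hA j k hk) hW t]
  have hS3 : ∫ ω, D.S₃ t ω * expI W t ω ∂P = ∑ j, ∑ k ∈ D.N j,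
      ∫ ω, ((∫ ω', D.X j ω' * D.Zjk j k ω' ∂P : ℝ) : ℂ)
        * ((D.Zj j ω : ℂ) + (D.Vjk j k ω : ℂ)) * taylorR 1 (-t * (D.Zj j ω + D.Vjk j k ω))
        * expI W t ω ∂P := by
    simp_rw [S₃, Finset.sum_mul]
    rw [integral_finsetSum _ fun j _ => integrable_finsetSum _ fun k hk =>
      integrable_mul_expI (integrable_S₃_term t hA j k hk) hW t]
    refine Finset.sum_congr rfl fun j _ => ?_
    rw [integral_finsetSum _ fun k hk =>
      integrable_mul_expI (integrable_S₃_term t hA j k hk) hW t]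
  have hc : ∑ j, ∑ k ∈ D.N j, ((∫ ω, D.X j ω * D.Zjk j k ω ∂P : ℝ) : ℂ) = 1 := by
    rw [← Complex.ofReal_one, ← D.sum_integral_X_mul_Zj]
    simp_rw [← D.sum_integral_X_mul_Zjk]
    push_cast
    rfl
  have hXZ : ∑ j, ∫ ω, ((D.X j ω * D.Zj j ω : ℝ) : ℂ) * expI W t ω ∂P =
      ∫ ω, expI W t ω ∂P + Complex.I * t * ∫ ω, D.S₂ t ω * expI W t ω ∂P
      - Complex.I * t * ∫ ω, D.S₃ t ω * expI W t ω ∂P := by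
    simp_rw [hZ]
    rw [Finset.sum_congr rfl fun j _ => Finset.sum_congr rfl fun k hk =>
      D.integral_X_mul_Zjk_mul_expI hA t j k hk]
    simp_rw [Finset.sum_sub_distrib, Finset.sum_add_distrib, ← Finset.sum_mul, ← Finset.mul_sum]
    rw [hS2, hS3, hc, one_mul]
  rw [h0]
  simp_rw [D.integral_X_mul_expI hA t]
  rw [Finset.sum_add_distrib, ← Finset.mul_sum, ← Finset.mul_sum, hXZ, ← hS1]
  linear_combination (t ^ 2 * (∫ ω, D.S₂ t ω * expI W t ω ∂P)
    - t ^ 2 * (∫ ω, D.S₃ t ω * expI W t ω ∂P)) * Complex.I_mul_I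

lemma hasDerivAt_charFun (D : BKRDecomposition P W J) (hA : D.A ≠ ∞) (t : ℝ) :
    HasDerivAt (charFun (P.map W)) (-t * charFun (P.map W) t
      + Complex.I * t ^ 2 * (∫ ω, D.S₁ t ω * expI W t ω ∂P + ∫ ω, D.S₃ t ω * expI W t ω ∂P
        - ∫ ω, D.S₂ t ω * expI W t ω ∂P)) t := by
  have hW := D.memLp_W.aestronglyMeasurable
  have := Measure.isProbabilityMeasure_map (μ := P) hW.aemeasurable
  have h1 : MemLp id 1 (P.map W) :=
    (memLp_map_measure_iff aestronglyMeasurable_id hW.aemeasurable).2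
      (D.memLp_W.mono_exponent (by norm_num))
  convert! IsProbabilityMeasure.hasDerivAt_charFun h1 t using 1
  rw [integral_map hW.aemeasurable (by fun_prop), charFun_map_eq_integral_expI hW]
  have := D.integral_W_mul_expI hA t
  simp only [expI] at this ⊢
  rw [this]
  linear_combination (-t * ∫ ω, Complex.exp (Complex.I * (t * W ω : ℝ)) ∂P) * Complex.I_mul_I

lemma norm_charFun_sub_exp_le (D : BKRDecomposition P W J) (hA : D.A ≠ ∞) (hB : D.B ≠ ∞) {t : ℝ}
    (ht : t ∈ Set.Icc 0 (1 / (2 * D.A.toReal))) :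
    ‖charFun (P.map W) t - Real.exp (-t ^ 2 / 2)‖ ≤
      D.A.toReal * t ^ 3 / 3 * Real.exp (-t ^ 2 / 4) + 2 * D.B.toReal * t := by
  have hW := D.memLp_W.aestronglyMeasurable
  have := Measure.isProbabilityMeasure_map (μ := P) hW.aemeasurable
  have hA0 : 0 < D.A.toReal := ENNReal.toReal_pos D.A_pos.ne' hA
  refine norm_sub_exp_le_of_hasDerivAt hA0.le ENNReal.toReal_nonneg ?_ (by simp)
    -- `a` collects the means of the S_i, controlled by `A`, and `b` their covariances with e^{itW},
    -- controlled by `B`.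
    (a := fun t => Complex.I * t ^ 2 *
      (∫ ω, D.S₁ t ω ∂P + ∫ ω, D.S₃ t ω ∂P - ∫ ω, D.S₂ t ω ∂P))
    (b := fun t => Complex.I * t ^ 2 * (
      (∫ ω, D.S₁ t ω * expI W t ω ∂P - (∫ ω, D.S₁ t ω ∂P) * ∫ ω, expI W t ω ∂P)
      + (∫ ω, D.S₃ t ω * expI W t ω ∂P - (∫ ω, D.S₃ t ω ∂P) * ∫ ω, expI W t ω ∂P)
      - (∫ ω, D.S₂ t ω * expI W t ω ∂P - (∫ ω, D.S₂ t ω ∂P) * ∫ ω, expI W t ω ∂P)))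
    ?_ ?_ ?_ ht
  · field_simp
    exact le_rfl
  · intro s
    convert! D.hasDerivAt_charFun hA s using 1
    rw [charFun_map_eq_integral_expI hW]
    ring
  · intro s
    rw [norm_mul, norm_mul, Complex.norm_I, one_mul, norm_pow, Complex.norm_real,
      Real.norm_eq_abs, sq_abs, mul_comm]
    gcongr
    rw [← toReal_enorm]
    refine ENNReal.toReal_mono hA ?_
    refine le_trans ?_ (D.sum_enorm_integral_le_A s hA)
    refine (enorm_sub_le).trans ((add_le_add_left (enorm_add_le _ _) _).trans_eq ?_)
    ring
  · intro s
    have hcov (S : Ω → ℂ) (hS : Integrable S P) :=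
      enorm_integral_mul_sub_le hS (aestronglyMeasurable_expI hW s)
        (fun ω => (norm_expI W s ω).le)
    rw [norm_mul, norm_mul, Complex.norm_I, one_mul, norm_pow, Complex.norm_real,
      Real.norm_eq_abs, sq_abs, mul_comm]
    gcongr
    rw [← toReal_enorm]
    refine ENNReal.toReal_mono hB ?_
    refine le_trans ?_ (le_iSup D.Bt s)
    refine (enorm_sub_le).trans ((add_le_add_left (enorm_add_le _ _) _).trans ?_)
    rw [Bt, add_right_comm]
    gcongr
    · exact hcov _ (integrable_S₁ s hA)
    · exact hcov _ (integrable_S₂ s hA)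
    · exact hcov _ (integrable_S₃ s hA)

end BKRDecomposition

/-! ### The Fejér kernel on the real line -/

/-- The Fejér kernel `(1 - cos x) / (π x²)`. -/
noncomputable def fejerKernel (x : ℝ) : ℝ :=
  Real.sinc (x / 2) ^ 2 / (2 * Real.pi)

lemma fejerKernel_nonneg (x : ℝ) : 0 ≤ fejerKernel x := by
  unfold fejerKernel
  positivity

lemma continuous_fejerKernel : Continuous fejerKernel := by
  unfold fejerKernel
  have := Real.continuous_sinc
  fun_prop

lemma fejerKernel_neg (x : ℝ) : fejerKernel (-x) = fejerKernel x := by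
  rw [fejerKernel, neg_div, Real.sinc_neg, fejerKernel]

lemma fejerKernel_le (x : ℝ) : fejerKernel x ≤ 1 / (2 * Real.pi) := by
  unfold fejerKernel
  gcongr
  exact (sq_le_one_iff_abs_le_one _).2 (Real.abs_sinc_le_one _)

lemma fejerKernel_mul_sq_le (x : ℝ) : fejerKernel x * x ^ 2 ≤ 2 / Real.pi := by
  rcases eq_or_ne x 0 with rfl | hx
  · simp
    positivity
  · have h2 : x / 2 ≠ 0 := by positivity
    rw [fejerKernel, Real.sinc_of_ne_zero h2]
    have h : (Real.sin (x / 2) / (x / 2)) ^ 2 / (2 * Real.pi) * x ^ 2 =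
        2 / Real.pi * Real.sin (x / 2) ^ 2 := by
      field_simp
    rw [h]
    exact mul_le_of_le_one_right (by positivity) (Real.sin_sq_le_one _)

lemma integrable_fejerKernel : Integrable fejerKernel := by
  refine integrable_inv_one_add_sq.mono' continuous_fejerKernel.aestronglyMeasurable
    (Filter.Eventually.of_forall fun x => ?_)
  rw [Real.norm_of_nonneg (fejerKernel_nonneg x), ← one_div, le_div_iff₀ (by positivity)]
  have h1 : 1 / (2 * Real.pi) + 2 / Real.pi ≤ 1 := by
    have := Real.pi_gt_three
    field_simp
    linarith
  linarith [fejerKernel_le x, fejerKernel_mul_sq_le x]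

lemma integral_one_sub_mul_cos (x : ℝ) :
    ∫ s in (0 : ℝ)..1, (1 - s) * Real.cos (s * x) = Real.pi * fejerKernel x := by
  rcases eq_or_ne x 0 with rfl | hx
  · have : ∫ s in (0 : ℝ)..1, (1 - s) = 1 / 2 := by
      rw [intervalIntegral.integral_sub (by simp) (by simp)]
      norm_num
    simp [fejerKernel, this]
  · have hd (s : ℝ) : HasDerivAt
        (fun s => (1 - s) * Real.sin (s * x) / x - Real.cos (s * x) / x ^ 2)
        ((1 - s) * Real.cos (s * x)) s := by
      have h1 : HasDerivAt (fun s => s * x) x s := hasDerivAt_mul_const x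
      have h2 : HasDerivAt (fun s : ℝ => 1 - s) (-1) s := by
        simpa using (hasDerivAt_id s).const_sub 1
      convert! ((h2.mul h1.sin).div_const x).sub (h1.cos.div_const (x ^ 2)) using 1
      field_simp
      ring
    rw [intervalIntegral.integral_eq_sub_of_hasDerivAt (fun s _ => hd s)
      (Continuous.intervalIntegrable (by fun_prop) _ _), fejerKernel,
      Real.sinc_of_ne_zero (by positivity)]
    have hc : Real.cos x = 1 - 2 * Real.sin (x / 2) ^ 2 := by
      have := Real.cos_two_mul' (x / 2)
      have h' := Real.sin_sq_add_cos_sq (x / 2)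
      rw [mul_div_cancel₀ _ two_ne_zero] at this
      linarith
    simp [hc]
    field_simp
    ring

/-- The compactly supported transform is the purpose of this kernel: smoothing at scale 1/T sees
characteristic functions only on [-T, T]. -/
lemma integral_triangle_mul_exp (x : ℝ) :
    ∫ s in (-1 : ℝ)..1, ((1 - |s| : ℝ) : ℂ) * Complex.exp (Complex.I * (s * x : ℝ)) =
      (2 * Real.pi * fejerKernel x : ℝ) := by
  have hc : Continuous fun s : ℝ =>
      ((1 - |s| : ℝ) : ℂ) * Complex.exp (Complex.I * (s * x : ℝ)) := by fun_prop
  rw [← intervalIntegral.integral_add_adjacent_intervals (b := 0)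
    (hc.intervalIntegrable _ _) (hc.intervalIntegrable _ _)]
  have h1 := intervalIntegral.integral_comp_neg (a := 0) (b := 1) (fun s : ℝ =>
      ((1 - |s| : ℝ) : ℂ) * Complex.exp (Complex.I * (s * x : ℝ)))
  rw [neg_zero] at h1
  have hc' : Continuous fun s : ℝ =>
      ((1 - |-s| : ℝ) : ℂ) * Complex.exp (Complex.I * (-s * x : ℝ)) := by fun_prop
  rw [← h1, ← intervalIntegral.integral_add (hc'.intervalIntegrable _ _)
    (hc.intervalIntegrable _ _), mul_assoc, ← integral_one_sub_mul_cos,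
    ← intervalIntegral.integral_const_mul, ← intervalIntegral.integral_ofReal]
  refine intervalIntegral.integral_congr fun s hs => ?_
  rw [Set.uIcc_of_le zero_le_one] at hs
  simp only [abs_neg, abs_of_nonneg hs.1]
  push_cast
  rw [mul_left_comm (2 : ℂ), Complex.two_cos]
  ring_nf

/-- This is Fourier inversion for the triangle function, evaluated at 0, where the triangle equals
1. -/
lemma integral_fejerKernel : ∫ x, fejerKernel x = 1 := by
  let f : ℝ → ℂ := fun s => ((max 0 (1 - |s|) : ℝ) : ℂ)
  have hfc : Continuous f := by fun_prop
  have hzero : ∀ s ∉ Set.Ioc (-1 : ℝ) 1, f s = 0 := by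
    intro s hs
    have : 1 ≤ |s| := by
      by_contra! h
      exact hs ⟨(abs_lt.1 h).1, (abs_lt.1 h).2.le⟩
    simp [f, this]
  have hfi : Integrable f := by
    refine hfc.integrable_of_hasCompactSupport (HasCompactSupport.intro' (K := Set.Icc (-1) 1)
      isCompact_Icc isClosed_Icc fun s hs => hzero s fun h => hs ⟨h.1.le, h.2⟩)
  have hF : FourierTransform.fourier f = fun ξ : ℝ =>
      ((2 * Real.pi * fejerKernel (2 * Real.pi * ξ) : ℝ) : ℂ) := by
    ext ξ
    rw [Real.fourier_real_eq_integral_exp_smul, ← fejerKernel_neg, ← integral_triangle_mul_exp,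
      intervalIntegral.integral_of_le (by norm_num)]
    rw [← setIntegral_eq_integral_of_forall_compl_eq_zero (s := Set.Ioc (-1 : ℝ) 1)
      fun s hs => by simp [hzero s hs]]
    refine setIntegral_congr_fun measurableSet_Ioc fun s hs => ?_
    have : 0 ≤ 1 - |s| := sub_nonneg.2 (abs_le.2 ⟨hs.1.le, hs.2⟩)
    simp only [f, max_eq_right this, smul_eq_mul]
    push_cast
    ring_nf
  have hFi : Integrable (FourierTransform.fourier f) := by
    rw [hF]
    exact ((integrable_fejerKernel.comp_mul_left' (by positivity)).const_mul _).ofReal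
  have h := congrFun (hfc.fourierInv_fourier_eq hfi hFi) 0
  rw [hF, Real.fourierInv_eq'] at h
  simp only [f, inner_zero_right, mul_zero, Complex.ofReal_zero, zero_mul, Complex.exp_zero,
    one_smul, abs_zero, sub_zero, integral_complex_ofReal, integral_const_mul,
    Measure.integral_comp_mul_left] at h
  have hpi : 0 < Real.pi := Real.pi_pos
  rw [abs_of_pos (by positivity), smul_eq_mul, mul_inv_cancel_left₀ (by positivity)] at h
  simpa using h

lemma integral_indicator_id_mul_fejerKernel (H : ℝ) :
    ∫ y, Set.indicator {y | |y| < H} (fun y => y * fejerKernel y) y = 0 := by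
  have h := integral_neg_eq_self
    (fun y => Set.indicator {y | |y| < H} (fun y => y * fejerKernel y) y) volume
  have h2 : (fun y => Set.indicator {y | |y| < H} (fun y => y * fejerKernel y) (-y)) =
      fun y => -Set.indicator {y | |y| < H} (fun y => y * fejerKernel y) y := by
    ext y
    simp only [Set.indicator, Set.mem_ofPred_eq, abs_neg, fejerKernel_neg]
    split_ifs <;> simp
  simp only [h2, integral_neg] at h
  linarith

lemma setIntegral_fejerKernel_le {H : ℝ} (hH : 0 < H) :
    ∫ y in {y | H ≤ |y|}, fejerKernel y ≤ 4 / (Real.pi * H) := by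
  have hset : {y : ℝ | H ≤ |y|} = Set.Iic (-H) ∪ Set.Ici H := by
    ext y
    simp [le_abs', or_comm]
  have h1 : ∫ y in Set.Ici H, fejerKernel y ≤ 2 / (Real.pi * H) := by
    rw [integral_Ici_eq_integral_Ioi]
    have hi := integrableOn_Ioi_rpow_of_lt (a := -2) (by norm_num) hH
    have hv := integral_Ioi_rpow_of_lt (a := -2) (by norm_num) hH
    calc ∫ y in Set.Ioi H, fejerKernel y ≤ ∫ y in Set.Ioi H, 2 / Real.pi * y ^ (-2 : ℝ) := by
          refine setIntegral_mono_on integrable_fejerKernel.integrableOn (hi.const_mul _)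
            measurableSet_Ioi fun y hy => ?_
          have hy0 : 0 < y := hH.trans hy
          rw [Real.rpow_neg hy0.le, Real.rpow_two, ← div_eq_mul_inv, le_div_iff₀ (by positivity)]
          exact fejerKernel_mul_sq_le y
      _ = 2 / (Real.pi * H) := by
          rw [integral_const_mul, hv]
          norm_num
          rw [Real.rpow_neg_one]
          field_simp
  have h2 : ∫ y in Set.Iic (-H), fejerKernel y = ∫ y in Set.Ici H, fejerKernel y := by
    rw [integral_Ici_eq_integral_Ioi, ← integral_comp_neg_Ioi]
    simp_rw [fejerKernel_neg]
  rw [hset, setIntegral_union ?_ measurableSet_Ici integrable_fejerKernel.integrableOn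
    integrable_fejerKernel.integrableOn, h2]
  · calc _ ≤ 2 / (Real.pi * H) + 2 / (Real.pi * H) := add_le_add h1 h1
      _ = _ := by ring
  · rw [Set.disjoint_left]
    intro y hy hy'
    simp only [Set.mem_Iic, Set.mem_Ici] at hy hy'
    linarith

/-- Lower bound for the smoothing of a bounded function that dominates an affine function near
the origin. -/
lemma le_integral_mul_fejerKernel {G : ℝ → ℝ} {η d a H : ℝ} (hH : 0 < H) (hd : 0 ≤ d)
    (hG : Measurable G) (hGη : ∀ y, |G y| ≤ η) (hlow : ∀ y, |y| < H → d + a * y ≤ G y) :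
    d - (η + d) * (4 / (Real.pi * H)) ≤ ∫ y, G y * fejerKernel y := by
  have hη : 0 ≤ η := (abs_nonneg _).trans (hGη 0)
  have hm1 : MeasurableSet {y : ℝ | |y| < H} := measurableSet_lt (by fun_prop) (by fun_prop)
  have hm2 : MeasurableSet {y : ℝ | H ≤ |y|} := measurableSet_le (by fun_prop) (by fun_prop)
  have i1 : Integrable (fun y => d * fejerKernel y) := integrable_fejerKernel.const_mul d
  -- The linear term is cut off at H: y K(y) is odd, so its truncated integral vanishes, but it is
  -- not absolutely integrable on the whole line.
  have i2 : Integrable (fun y =>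
      a * Set.indicator {y | |y| < H} (fun y => y * fejerKernel y) y) := by
    refine Integrable.const_mul ?_ a
    refine (integrable_fejerKernel.const_mul H).mono'
      (((continuous_id.mul continuous_fejerKernel).measurable.indicator hm1).aestronglyMeasurable)
      (Filter.Eventually.of_forall fun y => ?_)
    simp only [Set.indicator, Set.mem_ofPred_eq]
    split_ifs with h
    · rw [norm_mul, Real.norm_of_nonneg (fejerKernel_nonneg y)]
      exact mul_le_mul_of_nonneg_right h.le (fejerKernel_nonneg y)
    · simpa using mul_nonneg hH.le (fejerKernel_nonneg y)
  have i3 : Integrable (fun y => (η + d) * Set.indicator {y | H ≤ |y|} fejerKernel y) :=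
    (integrable_fejerKernel.indicator hm2).const_mul _
  have i4 : Integrable (fun y => G y * fejerKernel y) :=
    integrable_fejerKernel.bdd_mul (c := η) hG.aestronglyMeasurable
      (Filter.Eventually.of_forall hGη)
  have i12 : Integrable (fun y => d * fejerKernel y
      + a * Set.indicator {y | |y| < H} (fun y => y * fejerKernel y) y) := i1.add i2
  calc d - (η + d) * (4 / (Real.pi * H))
      ≤ d - (η + d) * ∫ y in {y | H ≤ |y|}, fejerKernel y := by
        gcongr
        exact setIntegral_fejerKernel_le hH
    _ = ∫ y, d * fejerKernel y + a * Set.indicator {y | |y| < H} (fun y => y * fejerKernel y) y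
          - (η + d) * Set.indicator {y | H ≤ |y|} fejerKernel y := by
        rw [integral_sub i12 i3, integral_add i1 i2, integral_const_mul, integral_const_mul,
          integral_const_mul, integral_indicator_id_mul_fejerKernel, integral_fejerKernel,
          integral_indicator hm2]
        ring
    -- Outside |y| < H only G ≥ -η = d - (η + d) is available.
    _ ≤ ∫ y, G y * fejerKernel y := by
        refine integral_mono (i12.sub i3) i4 fun y => ?_
        have hK := fejerKernel_nonneg y
        simp only [Set.indicator, Set.mem_ofPred_eq]
        rcases lt_or_ge |y| H with h | h
        · rw [if_pos h, if_neg h.not_ge]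
          nlinarith [hlow y h]
        · rw [if_neg h.not_gt, if_pos h]
          nlinarith [(abs_le.1 (hGη y)).1]

/-! ### Esseen's smoothing inequality -/

/-- The difference of the indicator functions of `[w, ∞)` and `[0, ∞)`. -/
noncomputable def stepDiff (w u : ℝ) : ℝ :=
  Set.indicator (Set.Ici w) 1 u - Set.indicator (Set.Ici 0) 1 u

lemma stepDiff_eq (w u : ℝ) :
    stepDiff w u = Set.indicator (Set.Ico w 0) 1 u - Set.indicator (Set.Ico 0 w) 1 u := by
  simp only [stepDiff, Set.indicator, Set.mem_Ici, Set.mem_Ico, Pi.one_apply]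
  grind

lemma abs_stepDiff (w u : ℝ) :
    |stepDiff w u| = Set.indicator (Set.Ico w 0) 1 u + Set.indicator (Set.Ico 0 w) 1 u := by
  simp only [stepDiff, Set.indicator, Set.mem_Ici, Set.mem_Ico, Pi.one_apply]
  grind

lemma measurable_stepDiff : Measurable (Function.uncurry stepDiff) := by
  have h1 : MeasurableSet {p : ℝ × ℝ | p.1 ≤ p.2} := measurableSet_le (by fun_prop) (by fun_prop)
  have h2 : MeasurableSet {p : ℝ × ℝ | 0 ≤ p.2} := measurableSet_le (by fun_prop) (by fun_prop)
  exact ((measurable_const (a := (1 : ℝ))).indicator h1).sub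
    ((measurable_const (a := (1 : ℝ))).indicator h2)

lemma integrable_indicator_Ico_one (a b : ℝ) :
    Integrable (Set.indicator (Set.Ico a b) (1 : ℝ → ℝ)) :=
  (integrable_indicator_iff measurableSet_Ico).2 (integrableOn_const (by simp))

lemma integrable_stepDiff (w : ℝ) : Integrable (stepDiff w) := by
  rw [funext (stepDiff_eq w)]
  exact (integrable_indicator_Ico_one w 0).sub (integrable_indicator_Ico_one 0 w)

lemma integral_abs_stepDiff (w : ℝ) : ∫ u, |stepDiff w u| = |w| := by
  simp_rw [abs_stepDiff]
  rw [integral_add (integrable_indicator_Ico_one w 0) (integrable_indicator_Ico_one 0 w),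
    integral_indicator_one measurableSet_Ico, integral_indicator_one measurableSet_Ico,
    Real.volume_real_Ico, Real.volume_real_Ico]
  rcases le_total w 0 with h | h
  · rw [max_eq_left (by linarith), max_eq_right (by linarith), abs_of_nonpos h]
    ring
  · rw [max_eq_right (by linarith), max_eq_left (by linarith), abs_of_nonneg h]
    ring

lemma integral_stepDiff_mul (w : ℝ) {f : ℝ → ℂ} (hf : Continuous f) :
    ∫ u, (stepDiff w u : ℂ) * f u = ∫ u in w..0, f u := by
  have h (u : ℝ) : (stepDiff w u : ℂ) * f u =
      Set.indicator (Set.Ico w 0) f u - Set.indicator (Set.Ico 0 w) f u := by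
    rw [stepDiff_eq]
    simp only [Set.indicator, Pi.one_apply]
    split_ifs <;> simp
  have hi (a b : ℝ) : IntegrableOn f (Set.Ico a b) :=
    (hf.integrableOn_Icc).mono_set Set.Ico_subset_Icc_self
  simp_rw [h]
  rw [integral_sub ((integrable_indicator_iff measurableSet_Ico).2 (hi _ _))
    ((integrable_indicator_iff measurableSet_Ico).2 (hi _ _)),
    integral_indicator measurableSet_Ico, integral_indicator measurableSet_Ico,
    integral_Ico_eq_integral_Ioc, integral_Ico_eq_integral_Ioc, intervalIntegral]

lemma I_mul_integral_exp (w t : ℝ) :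
    Complex.I * t * ∫ u in w..0, Complex.exp (Complex.I * (t * u : ℝ)) =
      1 - Complex.exp (Complex.I * (t * w : ℝ)) := by
  have hd (u : ℝ) : HasDerivAt (fun u : ℝ => Complex.exp (Complex.I * (t * u : ℝ)))
      (Complex.I * t * Complex.exp (Complex.I * (t * u : ℝ))) u := by
    have h0 : HasDerivAt (fun u : ℝ => Complex.I * (t * u : ℝ)) (Complex.I * t) u := by
      simpa using ((hasDerivAt_id u).const_mul t).ofReal_comp.const_mul Complex.I
    convert! h0.cexp using 1
    ring
  rw [← intervalIntegral.integral_const_mul,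
    intervalIntegral.integral_eq_sub_of_hasDerivAt (fun u _ => hd u)
      (Continuous.intervalIntegrable (by fun_prop) _ _)]
  simp

/-- The u-section has L¹ norm |w|, so a first moment is exactly what Fubini needs. Subtracting the
step at 0 is what makes a distribution function integrable. -/
lemma integrable_stepDiff_prod {μ : Measure ℝ} (hμ : Integrable id μ) :
    Integrable (Function.uncurry stepDiff) (μ.prod volume) := by
  rw [integrable_prod_iff measurable_stepDiff.aestronglyMeasurable]
  refine ⟨Filter.Eventually.of_forall integrable_stepDiff, ?_⟩
  simp only [Function.uncurry_apply_pair, Real.norm_eq_abs, integral_abs_stepDiff]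
  exact hμ.abs

lemma abs_cdf_sub_cdf_le_one (μ ν : Measure ℝ) (x : ℝ) : |cdf μ x - cdf ν x| ≤ 1 := by
  rw [abs_le]
  constructor <;> linarith [cdf_nonneg μ x, cdf_nonneg ν x, cdf_le_one μ x, cdf_le_one ν x]

lemma abs_cdf_sub_cdf_le_kolmogorovDist (μ ν : Measure ℝ) (x : ℝ) :
    |cdf μ x - cdf ν x| ≤ kolmogorovDist μ ν :=
  le_ciSup (f := fun x => |cdf μ x - cdf ν x|)
    ⟨1, by rintro _ ⟨y, rfl⟩; exact abs_cdf_sub_cdf_le_one μ ν y⟩ x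

section

variable {μ : Measure ℝ} [IsProbabilityMeasure μ]

lemma integral_stepDiff (u : ℝ) :
    ∫ w, stepDiff w u ∂μ = cdf μ u - Set.indicator (Set.Ici 0) 1 u := by
  have h (w : ℝ) : stepDiff w u =
      Set.indicator (Set.Iic u) 1 w - Set.indicator (Set.Ici (0 : ℝ)) 1 u := by
    simp [stepDiff, Set.indicator]
  simp_rw [h]
  rw [integral_sub ((integrable_indicator_iff measurableSet_Iic).2
    (integrableOn_const (by simp))) (integrable_const _),
    integral_indicator_one measurableSet_Iic, cdf_eq_real]
  simp

lemma integrable_cdf_sub_indicator (hμ : Integrable id μ) :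
    Integrable fun u => cdf μ u - Set.indicator (Set.Ici (0 : ℝ)) 1 u := by
  simp_rw [← integral_stepDiff (μ := μ)]
  exact (integrable_stepDiff_prod hμ).integral_prod_right

/-- The Fourier transform of a centred distribution function. -/
lemma I_mul_integral_cdf_sub_indicator_mul_exp (hμ : Integrable id μ) (t : ℝ) :
    Complex.I * t * ∫ u, ((cdf μ u - Set.indicator (Set.Ici (0 : ℝ)) 1 u : ℝ) : ℂ)
      * Complex.exp (Complex.I * (t * u : ℝ)) = 1 - charFun μ t := by
  have hint : Integrable (Function.uncurry fun w u =>
      (stepDiff w u : ℂ) * Complex.exp (Complex.I * (t * u : ℝ))) (μ.prod volume) := by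
    refine (integrable_stepDiff_prod hμ).ofReal.mul_bdd (c := 1)
      (g := fun p : ℝ × ℝ => Complex.exp (Complex.I * (t * p.2 : ℝ))) (by fun_prop)
      (Filter.Eventually.of_forall fun p => (Complex.norm_exp_I_mul_ofReal _).le)
  simp_rw [← integral_stepDiff (μ := μ), ← integral_complex_ofReal, ← integral_mul_const]
  rw [← integral_integral_swap hint, ← integral_const_mul]
  simp_rw [integral_stepDiff_mul _ (f := fun u : ℝ => Complex.exp (Complex.I * (t * u : ℝ)))
    (by fun_prop), I_mul_integral_exp]
  rw [integral_sub (integrable_const _), charFun_apply_real]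
  · simp [mul_comm]
  · exact Integrable.of_bound (by fun_prop) 1
      (Filter.Eventually.of_forall fun p => (Complex.norm_exp_I_mul_ofReal _).le)

variable {ν : Measure ℝ} [IsProbabilityMeasure ν]

lemma integrable_cdf_sub_cdf (hμ : Integrable id μ) (hν : Integrable id ν) :
    Integrable fun u => cdf μ u - cdf ν u := by
  refine ((integrable_cdf_sub_indicator hμ).sub (integrable_cdf_sub_indicator hν)).congr
    (Filter.Eventually.of_forall fun u => ?_)
  simp

lemma I_mul_integral_cdf_sub_cdf_mul_exp (hμ : Integrable id μ) (hν : Integrable id ν) (t : ℝ) :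
    Complex.I * t * ∫ u, ((cdf μ u - cdf ν u : ℝ) : ℂ)
      * Complex.exp (Complex.I * (t * u : ℝ)) = charFun ν t - charFun μ t := by
  have h (ρ : Measure ℝ) [IsProbabilityMeasure ρ] (hρ : Integrable id ρ) :
      Integrable fun u => ((cdf ρ u - Set.indicator (Set.Ici (0 : ℝ)) 1 u : ℝ) : ℂ)
      * Complex.exp (Complex.I * (t * u : ℝ)) :=
    (integrable_cdf_sub_indicator hρ).ofReal.mul_bdd (c := 1) (by fun_prop)
      (Filter.Eventually.of_forall fun p => (Complex.norm_exp_I_mul_ofReal _).le)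
  have e : charFun ν t - charFun μ t = (1 - charFun μ t) - (1 - charFun ν t) := by ring
  rw [e, ← I_mul_integral_cdf_sub_indicator_mul_exp hμ,
    ← I_mul_integral_cdf_sub_indicator_mul_exp hν, ← mul_sub, ← integral_sub (h μ hμ) (h ν hν)]
  congr 2
  ext u
  push_cast
  ring

/-- Fourier bound for the difference of two distribution functions smoothed by the Fejér
kernel. -/
lemma abs_integral_cdf_sub_cdf_mul_fejerKernel_le (hμ : Integrable id μ) (hν : Integrable id ν)
    {T : ℝ} (hT : 0 < T) {g : ℝ → ℝ} (hg : Continuous g)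
    (hφ : ∀ t ∈ Set.Icc (-T) T, ‖charFun μ t - charFun ν t‖ ≤ |t| * g t) (c : ℝ) :
    |∫ y, (cdf μ (c - y / T) - cdf ν (c - y / T)) * fejerKernel y| ≤
      1 / (2 * Real.pi) * ∫ t in (-T)..T, g t := by
  set Δ : ℝ → ℝ := fun u => cdf μ u - cdf ν u with hΔ
  have hΔi : Integrable Δ := integrable_cdf_sub_cdf hμ hν
  have hΔc : Integrable fun y => Δ (c - y / T) := by
    have := (hΔi.comp_sub_left c).comp_div hT.ne'
    exact this
  -- the inner Fourier integral
  have hinner (s : ℝ) : ∫ y, (Δ (c - y / T) : ℂ) * Complex.exp (Complex.I * (s * y : ℝ)) =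
      T * Complex.exp (Complex.I * (s * T * c : ℝ)) *
        ∫ u, (Δ u : ℂ) * Complex.exp (Complex.I * (-(s * T) * u : ℝ)) := by
    have h1 := Measure.integral_comp_div (fun y : ℝ =>
      (Δ (c - y) : ℂ) * Complex.exp (Complex.I * (s * T * y : ℝ))) T
    have h2 := integral_sub_left_eq_self (fun u : ℝ =>
      (Δ u : ℂ) * Complex.exp (Complex.I * (s * T * (c - u) : ℝ))) volume c
    simp only [sub_sub_cancel] at h2
    have h3 (y : ℝ) : s * T * (y / T) = s * y := by field_simp
    simp only [h3, h2, abs_of_pos hT] at h1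
    have h4 : ∫ u, (Δ u : ℂ) * Complex.exp (Complex.I * (s * T * (c - u) : ℝ)) =
        Complex.exp (Complex.I * (s * T * c : ℝ)) *
          ∫ u, (Δ u : ℂ) * Complex.exp (Complex.I * (-(s * T) * u : ℝ)) := by
      rw [← integral_const_mul]
      refine integral_congr_ae (Filter.Eventually.of_forall fun u => ?_)
      simp only
      rw [mul_left_comm, ← Complex.exp_add]
      push_cast
      ring_nf
    rw [h1, h4, Complex.real_smul, ← mul_assoc (T : ℂ)]
  -- The transform of the difference of distribution functions is that of the laws divided by the
  -- frequency; this cancels |t| in `hφ` and excludes the null set s = 0.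
  have hbound (s : ℝ) (hs : s ∈ Set.Icc (-1 : ℝ) 1) (hs0 : s ≠ 0) :
      ‖∫ y, (Δ (c - y / T) : ℂ) * Complex.exp (Complex.I * (s * y : ℝ))‖ ≤ T * g (-(s * T)) := by
    have hsT : -(s * T) ∈ Set.Icc (-T) T := by
      constructor <;> nlinarith [hs.1, hs.2]
    have h1 := hφ _ hsT
    have hpos : 0 < |-(s * T)| := abs_pos.2 (neg_ne_zero.2 (mul_ne_zero hs0 hT.ne'))
    rw [norm_sub_rev, ← I_mul_integral_cdf_sub_cdf_mul_exp hμ hν, norm_mul, norm_mul,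
      Complex.norm_I, one_mul, Complex.norm_real, Real.norm_eq_abs] at h1
    rw [hinner, norm_mul, norm_mul, Complex.norm_exp_I_mul_ofReal, mul_one, Complex.norm_real,
      Real.norm_of_nonneg hT.le]
    exact mul_le_mul_of_nonneg_left (le_of_mul_le_mul_left h1 hpos) hT.le
  have hint : Integrable (Function.uncurry fun (y s : ℝ) => (Δ (c - y / T) : ℂ) *
      (((1 - |s| : ℝ) : ℂ) * Complex.exp (Complex.I * (s * y : ℝ))))
      (volume.prod (volume.restrict (Set.Ioc (-1 : ℝ) 1))) := by
    have h1 : Integrable (fun s : ℝ => ((1 - |s| : ℝ) : ℂ))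
        (volume.restrict (Set.Ioc (-1 : ℝ) 1)) :=
      (Continuous.integrableOn_Icc (by fun_prop)).mono_set Set.Ioc_subset_Icc_self
    have h2 := (hΔc.ofReal (𝕜 := ℂ)).mul_prod h1
    have h3 := h2.mul_bdd (c := 1)
      (g := fun p : ℝ × ℝ => Complex.exp (Complex.I * (p.2 * p.1 : ℝ))) (by fun_prop)
      (Filter.Eventually.of_forall fun p => (Complex.norm_exp_I_mul_ofReal _).le)
    refine h3.congr (Filter.Eventually.of_forall fun p => ?_)
    simp [Function.uncurry, mul_assoc]
  have hswap : ((2 * Real.pi : ℝ) : ℂ) * ((∫ y, Δ (c - y / T) * fejerKernel y : ℝ) : ℂ) =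
      ∫ s in (-1 : ℝ)..1, ((1 - |s| : ℝ) : ℂ) *
        ∫ y, (Δ (c - y / T) : ℂ) * Complex.exp (Complex.I * (s * y : ℝ)) := by
    rw [intervalIntegral.integral_of_le (by norm_num)]
    simp_rw [← integral_const_mul]
    have e : ∀ s y : ℝ, ((1 - |s| : ℝ) : ℂ) *
        ((Δ (c - y / T) : ℂ) * Complex.exp (Complex.I * (s * y : ℝ))) =
        (Δ (c - y / T) : ℂ) *
        (((1 - |s| : ℝ) : ℂ) * Complex.exp (Complex.I * (s * y : ℝ))) := fun s y => by ring
    simp_rw [e]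
    rw [← integral_integral_swap hint, ← integral_complex_ofReal, ← integral_const_mul]
    congr 1
    ext y
    rw [integral_const_mul, ← intervalIntegral.integral_of_le (by norm_num),
      integral_triangle_mul_exp]
    push_cast
    ring
  have hfin : ‖((2 * Real.pi : ℝ) : ℂ) * ((∫ y, Δ (c - y / T) * fejerKernel y : ℝ) : ℂ)‖ ≤
      ∫ t in (-T)..T, g t := by
    rw [hswap]
    have h1 : ∫ t in (-T)..T, g t = ∫ s in (-1 : ℝ)..1, T * g (-(s * T)) := by
      rw [intervalIntegral.integral_const_mul, ← smul_eq_mul,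
        intervalIntegral.smul_integral_comp_mul_right (fun x => g (-x)),
        intervalIntegral.integral_comp_neg]
      simp
    rw [h1]
    refine intervalIntegral.norm_integral_le_of_norm_le (by norm_num) ?_
      (Continuous.intervalIntegrable (by fun_prop) _ _)
    have hne : ∀ᵐ s : ℝ, s ≠ 0 := Measure.ae_ne volume 0
    filter_upwards [hne] with s hs0 hs
    have hs' : s ∈ Set.Icc (-1 : ℝ) 1 := Set.Ioc_subset_Icc_self hs
    rw [norm_mul, Complex.norm_real, Real.norm_of_nonneg (sub_nonneg.2 (abs_le.2 hs'))]
    exact (mul_le_of_le_one_left (norm_nonneg _) (by simp)).trans (hbound s hs' hs0)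
  rw [norm_mul, Complex.norm_real, Complex.norm_real, Real.norm_of_nonneg (by positivity),
    Real.norm_eq_abs] at hfin
  rw [one_div, ← div_eq_inv_mul, le_div_iff₀ (by positivity), mul_comm]
  exact hfin

/-- Esseen's smoothing inequality. -/
theorem kolmogorovDist_le_of_charFun_sub_le (hμ : Integrable id μ) (hν : Integrable id ν)
    {m : ℝ} (hm : 0 < m) (hlip : ∀ x y, x ≤ y → cdf ν y - cdf ν x ≤ m * (y - x))
    {T : ℝ} (hT : 0 < T) {g : ℝ → ℝ} (hg : Continuous g)
    (hφ : ∀ t ∈ Set.Icc (-T) T, ‖charFun μ t - charFun ν t‖ ≤ |t| * g t) :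
    kolmogorovDist μ ν ≤
      1 / Real.pi * (∫ t in (-T)..T, g t) + 24 * m / (Real.pi * T) := by
  set η := kolmogorovDist μ ν with hη
  set M := 1 / (2 * Real.pi) * ∫ t in (-T)..T, g t with hM
  have hpi := Real.pi_pos
  have hη0 : 0 ≤ η := (abs_nonneg _).trans (abs_cdf_sub_cdf_le_kolmogorovDist μ ν 0)
  have hM0 : 0 ≤ M :=
    (abs_nonneg _).trans (abs_integral_cdf_sub_cdf_mul_fejerKernel_le hμ hν hT hg hφ 0)
  have hMe : 1 / Real.pi * (∫ t in (-T)..T, g t) = 2 * M := by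
    rw [hM]
    field_simp
  rw [hMe]
  rcases hη0.eq_or_lt with h0 | hηpos
  · rw [← h0]
    positivity
  have hmeas (c : ℝ) : Measurable fun y : ℝ => cdf μ (c - y / T) - cdf ν (c - y / T) :=
    ((monotone_cdf μ).measurable.comp (by fun_prop)).sub
      ((monotone_cdf ν).measurable.comp (by fun_prop))
  -- Where the difference exceeds δ in modulus, monotonicity of one distribution function and the
  -- Lipschitz bound on the other keep it above an affine function on a window of length 2h, h =
  -- δ/(2m), to the right or left according to sign. Centring there gives d = δ/2 and H = hT.
  have key : ∀ δ ∈ Set.Ioo 0 η, δ / 2 - (η + δ / 2) * (8 * m / (Real.pi * T * δ)) ≤ M := by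
    intro δ hδ
    have hδ0 : 0 < δ := hδ.1
    obtain ⟨x, hx⟩ := exists_lt_of_lt_ciSup hδ.2
    set h := δ / (2 * m) with hh
    have hhpos : 0 < h := by positivity
    have hmh : m * h = δ / 2 := by
      rw [hh]
      field_simp
    have hconst : 8 * m / (Real.pi * T * δ) = 4 / (Real.pi * (h * T)) := by
      rw [hh]
      field_simp
      norm_num
    rw [hconst]
    have hHpos : 0 < h * T := by positivity
    rcases lt_abs.1 hx with hx | hx
    · refine (le_integral_mul_fejerKernel (a := m / T) hHpos (by positivity) (hmeas (x + h))
        (fun y => abs_cdf_sub_cdf_le_kolmogorovDist μ ν _) fun y hy => ?_).trans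
        ((le_abs_self _).trans
          (abs_integral_cdf_sub_cdf_mul_fejerKernel_le hμ hν hT hg hφ (x + h)))
      have hy' : y / T < h := (div_lt_iff₀ hT).2 (abs_lt.1 hy).2
      have h1 : cdf μ x ≤ cdf μ (x + h - y / T) := monotone_cdf μ (by linarith)
      have h2 := hlip x (x + h - y / T) (by linarith)
      have h3 : m * (x + h - y / T - x) = δ / 2 - m / T * y := by
        rw [← hmh]
        ring
      linarith
    · refine (le_integral_mul_fejerKernel (a := -(m / T)) hHpos (by positivity)
        (hmeas (x - h)).neg
        (fun y => (abs_neg _).trans_le (abs_cdf_sub_cdf_le_kolmogorovDist μ ν _))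
        fun y hy => ?_).trans ?_
      · have hy' : -h < y / T := (lt_div_iff₀ hT).2 (by linarith [(abs_lt.1 hy).1])
        have h1 : cdf μ (x - h - y / T) ≤ cdf μ x := monotone_cdf μ (by linarith)
        have h2 := hlip (x - h - y / T) x (by linarith)
        have h3 : m * (x - (x - h - y / T)) = δ / 2 + m / T * y := by
          rw [← hmh]
          ring
        simp only [Pi.neg_apply]
        linarith
      · simp only [Pi.neg_apply, neg_mul, integral_neg]
        exact (neg_le_abs _).trans
          (abs_integral_cdf_sub_cdf_mul_fejerKernel_le hμ hν hT hg hφ (x - h))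
  -- The supremum need not be attained, so δ increases to η; the limit reads η/2 - 12m/(πT) ≤ M.
  have hlim : Filter.Tendsto (fun δ : ℝ => δ / 2 - (η + δ / 2) * (8 * m / (Real.pi * T * δ)))
      (nhdsWithin η (Set.Iio η))
      (nhds (η / 2 - (η + η / 2) * (8 * m / (Real.pi * T * η)))) := by
    refine (ContinuousAt.tendsto ?_).mono_left nhdsWithin_le_nhds
    have : Real.pi * T * η ≠ 0 := by positivity
    fun_prop (disch := assumption)
  have hfinal := le_of_tendsto hlim
    (Filter.eventually_of_mem (Ioo_mem_nhdsLT hηpos) key)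
  have e : (η + η / 2) * (8 * m / (Real.pi * T * η)) = 12 * m / (Real.pi * T) := by
    field_simp
    norm_num
  rw [e] at hfinal
  have e2 : 24 * m / (Real.pi * T) = 2 * (12 * m / (Real.pi * T)) := by ring
  rw [e2]
  linarith

end

/-! ### The normal approximation bound -/

lemma integrable_sq_mul_exp_neg : Integrable fun t : ℝ => t ^ 2 * Real.exp (-t ^ 2 / 4) := by
  have h := integrable_rpow_mul_exp_neg_mul_sq (b := 1 / 4) (by norm_num) (s := 2) (by norm_num)
  refine h.congr (Filter.Eventually.of_forall fun t => ?_)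
  simp only [Real.rpow_two]
  ring_nf

/-- Up to the factor 2√π this is the variance of N(0, 2). -/
lemma integral_sq_mul_exp_neg :
    ∫ t : ℝ, t ^ 2 * Real.exp (-t ^ 2 / 4) = 4 * √Real.pi := by
  have h := variance_id_gaussianReal (μ := 0) (v := 2)
  rw [variance_of_integral_eq_zero aemeasurable_id (by simp),
    integral_gaussianReal_eq_integral_smul two_ne_zero] at h
  have e (t : ℝ) : gaussianPDFReal 0 2 t • (id t ^ 2) =
      (2 * √Real.pi)⁻¹ * (t ^ 2 * Real.exp (-t ^ 2 / 4)) := by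
    have h4 : √(2 * Real.pi * 2) = 2 * √Real.pi := by
      rw [show 2 * Real.pi * 2 = 2 ^ 2 * Real.pi by ring, Real.sqrt_mul (by positivity),
        Real.sqrt_sq (by positivity)]
    rw [gaussianPDFReal]
    norm_num [h4]
    ring
  simp_rw [e] at h
  rw [integral_const_mul, inv_mul_eq_iff_eq_mul₀ (by positivity)] at h
  rw [h]
  norm_num
  ring

lemma cdf_gaussianReal_sub_le (x y : ℝ) (hxy : x ≤ y) :
    cdf (gaussianReal 0 1) y - cdf (gaussianReal 0 1) x ≤ (√(2 * Real.pi))⁻¹ * (y - x) := by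
  rw [cdf_eq_real, cdf_eq_real, ← measureReal_sdiff (Set.Iic_subset_Iic.2 hxy) measurableSet_Iic]
  have hset : Set.Iic y \ Set.Iic x = Set.Ioc x y := by
    ext
    simp [and_comm]
  rw [hset, measureReal_def, gaussianReal_apply_eq_integral 0 one_ne_zero,
    ENNReal.toReal_ofReal (setIntegral_nonneg measurableSet_Ioc fun t _ =>
      gaussianPDFReal_nonneg 0 1 t), ← intervalIntegral.integral_of_le hxy]
  have hb (t : ℝ) : gaussianPDFReal 0 1 t ≤ (√(2 * Real.pi))⁻¹ := by
    rw [gaussianPDFReal]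
    simp only [NNReal.coe_one, mul_one, sub_zero]
    exact mul_le_of_le_one_right (by positivity) (Real.exp_le_one_iff.2 (by
      rw [neg_div]; exact neg_nonpos.2 (by positivity)))
  calc _ ≤ ∫ _ in x..y, (√(2 * Real.pi))⁻¹ :=
        intervalIntegral.integral_mono_on hxy (integrable_gaussianPDFReal 0 1).intervalIntegrable
          (by simp) fun t _ => hb t
    _ = _ := by rw [intervalIntegral.integral_const, smul_eq_mul, mul_comm]

namespace BKRDecomposition

variable {Ω : Type*} [MeasurableSpace Ω] {P : Measure Ω} [IsProbabilityMeasure P] {W : Ω → ℝ}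
  {J : Type*} [Fintype J]

lemma kolmogorovDist_le (D : BKRDecomposition P W J) (hA : D.A ≠ ∞) (hB : D.B ≠ ∞) :
    kolmogorovDist (P.map W) (gaussianReal 0 1) ≤
      (4 / (3 * √Real.pi) + 24 * √2 / (Real.pi * √Real.pi)) * D.A.toReal
        + 2 / Real.pi * (D.B.toReal / D.A.toReal) := by
  have hW := D.memLp_W.aestronglyMeasurable
  have := Measure.isProbabilityMeasure_map (μ := P) hW.aemeasurable
  have hA0 : 0 < D.A.toReal := ENNReal.toReal_pos D.A_pos.ne' hA
  have hμ : Integrable id (P.map W) :=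
    (integrable_map_measure aestronglyMeasurable_id hW.aemeasurable).2
      (D.memLp_W.integrable (by norm_num))
  have hν : Integrable id (gaussianReal 0 1) :=
    (memLp_id_gaussianReal (μ := 0) (v := 1) 1).integrable (by norm_num)
  set a := D.A.toReal
  set b := D.B.toReal with hb
  have hb0 : 0 ≤ b := ENNReal.toReal_nonneg
  -- The largest range on which the Grönwall estimate holds.
  set T := 1 / (2 * a) with hT
  have hT0 : 0 < T := by positivity
  let g : ℝ → ℝ := fun t => a / 3 * (t ^ 2 * Real.exp (-t ^ 2 / 4)) + 2 * b
  have hγ (t : ℝ) : charFun (gaussianReal 0 1) t = Real.exp (-t ^ 2 / 2) := by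
    rw [charFun_gaussianReal]
    push_cast
    simp [neg_div]
  have hpos : ∀ t ∈ Set.Icc 0 T,
      ‖charFun (P.map W) t - charFun (gaussianReal 0 1) t‖ ≤ |t| * g t := by
    intro t ht
    rw [hγ, abs_of_nonneg ht.1]
    refine (D.norm_charFun_sub_exp_le hA hB ht).trans_eq ?_
    simp only [g]
    ring
  have hφ : ∀ t ∈ Set.Icc (-T) T,
      ‖charFun (P.map W) t - charFun (gaussianReal 0 1) t‖ ≤ |t| * g t := by
    intro t ht
    rcases le_total 0 t with h | h
    · exact hpos t ⟨h, ht.2⟩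
    -- Negative t follows by conjugation, as `g` is even.
    · have := hpos (-t) ⟨by linarith, by linarith [ht.1]⟩
      rw [charFun_neg, charFun_neg, ← map_sub, RCLike.norm_conj, abs_neg] at this
      simpa [g] using this
  have hmain := kolmogorovDist_le_of_charFun_sub_le hμ hν (m := (√(2 * Real.pi))⁻¹)
    (by positivity) cdf_gaussianReal_sub_le hT0 (g := g) (by fun_prop) hφ
  have hg : ∫ t in (-T)..T, g t ≤ a / 3 * (4 * √Real.pi) + 4 * b * T := by
    simp only [g]
    rw [intervalIntegral.integral_add (Continuous.intervalIntegrable (by fun_prop) _ _) (by simp),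
      intervalIntegral.integral_const_mul, intervalIntegral.integral_const, smul_eq_mul,
      ← integral_sq_mul_exp_neg, intervalIntegral.integral_of_le (by linarith)]
    have : ∫ t in Set.Ioc (-T) T, t ^ 2 * Real.exp (-t ^ 2 / 4) ≤
        ∫ t : ℝ, t ^ 2 * Real.exp (-t ^ 2 / 4) :=
      setIntegral_le_integral integrable_sq_mul_exp_neg
        (Filter.Eventually.of_forall fun t => by positivity)
    have h2 := mul_le_mul_of_nonneg_left this (show 0 ≤ a / 3 by positivity)
    linarith
  have hs : √Real.pi * √Real.pi = Real.pi := Real.mul_self_sqrt Real.pi_pos.le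
  have hs2 : √2 * √2 = (2 : ℝ) := Real.mul_self_sqrt (by norm_num)
  have hsp : 0 < √Real.pi := Real.sqrt_pos.2 Real.pi_pos
  have hs2p : (0 : ℝ) < √2 := by positivity
  refine hmain.trans ?_
  -- Here 4bT = 2b/a, and 24m/(πT) = 48a/(π√(2π)) with m = 1/√(2π).
  calc _ ≤ 1 / Real.pi * (a / 3 * (4 * √Real.pi) + 4 * b * T)
        + 24 * (√(2 * Real.pi))⁻¹ / (Real.pi * T) := by gcongr
    _ = 4 / 3 * (√Real.pi / Real.pi) * a + 24 * (2 / √2) / (Real.pi * √Real.pi) * a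
        + 2 / Real.pi * (b / a) := by
        rw [hT, Real.sqrt_mul (by norm_num)]
        field_simp
        ring
    _ = _ := by
        have e1 : √Real.pi / Real.pi = 1 / √Real.pi := by
          rw [div_eq_div_iff Real.pi_pos.ne' hsp.ne', hs, one_mul]
        have e2 : 2 / √2 = √2 := by
          rw [div_eq_iff hs2p.ne', hs2]
        rw [e1, e2]
        field_simp

end BKRDecomposition

theorem mainTheorem2 {Ω : Type*} [MeasurableSpace Ω] (P : Measure Ω) [IsProbabilityMeasure P]
    (W : Ω → ℝ) (J : Type*) [Fintype J] (D : BKRDecomposition P W J) :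
    0 < D.A ∧
    ENNReal.ofReal (kolmogorovDist (P.map W) (gaussianReal 0 1)) ≤
      ENNReal.ofReal (4 / (3 * √Real.pi) + 24 * √2 / (Real.pi * √Real.pi)) * D.A
        + ENNReal.ofReal (2 / Real.pi) * (D.B / D.A) := by
  refine ⟨D.A_pos, ?_⟩
  have hpi := Real.pi_pos
  have hc1 : 0 < 4 / (3 * √Real.pi) + 24 * √2 / (Real.pi * √Real.pi) := by positivity
  have hc2 : 0 < 2 / Real.pi := by positivity
  -- If `D.A` is infinite the first summand already is, whatever `D.B / D.A` means.
  by_cases hA : D.A = ∞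
  · simp [hA, ENNReal.mul_top, hc1]
  by_cases hB : D.B = ∞
  · simp [hB, ENNReal.top_div_of_ne_top hA, ENNReal.mul_top, hpi]
  have hA0 : 0 < D.A.toReal := ENNReal.toReal_pos D.A_pos.ne' hA
  refine (ENNReal.ofReal_le_ofReal (D.kolmogorovDist_le hA hB)).trans_eq ?_
  rw [ENNReal.ofReal_add (by positivity) (by positivity), ENNReal.ofReal_mul hc1.le,
    ENNReal.ofReal_mul hc2.le, ENNReal.ofReal_div_of_pos hA0, ENNReal.ofReal_toReal hA,
    ENNReal.ofReal_toReal hB]
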